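/- Fix a universe of small sets, and let $\mathcal{C}$ be a (possibly large) locally small category with finite limits. A presheaf $\phi\colon \mathcal{C}^{\mathrm{op}}\to\mathbf{Set}$ is *small* if it is the left Kan extension of its restriction to some full subcategory of $\mathcal{C}$ having only a small set of isomorphism classes of objects. Let $\mathcal{P}\mathcal{C}$ be the category of small presheaves on $\mathcal{C}$ (the free cocompletion of $\mathcal{C}$) and $Y\colon\mathcal{C}\to\mathcal{P}\mathcal{C}$ the Yoneda embedding. The assignment $\mathcal{C}\mapsto\mathcal{P}\mathcal{C}$ underlies the free cocompletion pseudomonad on the 2-category of locally small categories, with unit $Y$, with $\mathcal{P}F$ the cocontinuous extension of $Y F$, and with multiplication $\mathcal{P}\mathcal{P}\mathcal{C}\to\mathcal{P}\mathcal{C}$ the cocontinuous extension of the identity. It restricts to a pseudomonad $\mathcal{P}_l$ on the 2-category $\mathbf{LEX}$ of finitely complete categories, finite-limit-preserving functors and natural transformations. A $\mathcal{P}_l$-pseudoalgebra structure on $\mathcal{C}$ is thus a $\mathcal{P}$-pseudoalgebra structure whose action $\mathcal{P}\mathcal{C}\to\mathcal{C}$ preserves finite limits. An *$\infty$-pretopos*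 is a category with finite limits and small colimits in which small colimits are stable under pullback, small coproducts are disjoint (the coproduct injections are monomorphisms, and the pullback of two distinct ones is initial), and every equivalence relation is effective (it is the kernel pair of its coequalizer). Then the following are equivalent: 1. $\mathcal{C}$ admits a $\mathcal{P}_l$-pseudoalgebra structure (that is, $\mathcal{C}$ is *small-exact*); 2. $Y\colon\mathcal{C}\to\mathcal{P}\mathcal{C}$ has a left adjoint that preserves finite limits; 3. $\mathcal{C}$ is an $\infty$-pretopos. In particular, a finitely complete and small-cocomplete locally small category is small-exact if and only if it is an $\infty$-pretopos. -/

import Mathlib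

universe w v u v' u' v'' u''

open CategoryTheory CategoryTheory.Limits CategoryTheory.Functor Opposite

namespace LexCocompletion

variable {C : Type u} [Category.{v} C]

/-- A presheaf of `w`-small sets is small when it is the (pointwise) left Kan extension of its
restriction to some essentially `w`-small full subcategory. -/
def IsSmallPresheaf : ObjectProperty (Cᵒᵖ ⥤ Type w) := fun φ =>
  ∃ L : ObjectProperty C, ObjectProperty.EssentiallySmall.{w} L ∧
    Nonempty ((LeftExtension.mk φ (𝟙 (L.ι.op ⋙ φ)) :
      L.ι.op.LeftExtension (L.ι.op ⋙ φ)).IsPointwiseLeftKanExtension)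

variable (C) in
/-- The category of small presheaves on `C`, the free cocompletion of `C`. -/
abbrev SmallPresheaf : Type (max u v (w + 1)) := (IsSmallPresheaf.{w} (C := C)).FullSubcategory

theorem isLeftKanExtension_of_bijective (L : ObjectProperty C) (φ : Cᵒᵖ ⥤ Type w)
    (h : ∀ (ψ : Cᵒᵖ ⥤ Type w) (β : L.ι.op ⋙ φ ⟶ L.ι.op ⋙ ψ),
      ∃! γ : φ ⟶ ψ, whiskerLeft L.ι.op γ = β) :
    φ.IsLeftKanExtension (𝟙 (L.ι.op ⋙ φ)) where
  nonempty_isUniversal := ⟨by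
    refine IsInitial.ofUniqueHom (fun E => StructuredArrow.homMk (h E.right E.hom).choose ?_) ?_
    · exact (Category.id_comp _).trans (h E.right E.hom).choose_spec.1
    · intro E m
      ext1
      apply (h E.right E.hom).choose_spec.2
      exact (Category.id_comp _).symm.trans (StructuredArrow.w m)⟩

variable [LocallySmall.{w} C]

instance (L : ObjectProperty C) [ObjectProperty.EssentiallySmall.{w} L]
    (F : L.FullSubcategoryᵒᵖ ⥤ Type w) : L.ι.op.HasPointwiseLeftKanExtension F := by
  intro c
  have := hasColimitsOfShape_of_essentiallySmall.{w} (CostructuredArrow L.ι.op c) (Type w)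
  infer_instance

instance small_natTrans (D : Type u') [Category.{v'} D] [EssentiallySmall.{w} D]
    (F G : D ⥤ Type w) : Small.{w} (F ⟶ G) := by
  let e := (equivSmallModel.{w} D).congrLeft (E := Type w)
  exact small_of_injective (β := e.functor.obj F ⟶ e.functor.obj G)
    (f := fun f => e.functor.map f) (e.functor.map_injective)

instance : LocallySmall.{w} (SmallPresheaf.{w} C) where
  hom_small φ ψ := by
    obtain ⟨L, _, ⟨h⟩⟩ := φ.property
    refine small_of_injective (β := (L.ι.op ⋙ φ.obj ⟶ L.ι.op ⋙ ψ.obj))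
      (f := fun f => whiskerLeft L.ι.op f.hom) ?_
    intro f g hfg
    apply ObjectProperty.hom_ext
    exact h.isUniversal.hom_ext ((Category.id_comp _).trans (hfg.trans (Category.id_comp _).symm))

theorem isSmallPresheaf_shrinkYoneda (X : C) :
    IsSmallPresheaf.{w} (shrinkYoneda.{w}.obj X) := by
  refine ⟨.ofObj (fun _ : PUnit.{w+1} => X), inferInstance, ?_⟩
  have hX : ObjectProperty.ofObj (fun _ : PUnit.{w+1} => X) X := ⟨PUnit.unit⟩
  have := isLeftKanExtension_of_bijective (.ofObj (fun _ : PUnit.{w+1} => X))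
    (shrinkYoneda.{w}.obj X) (fun ψ β => by
      refine ⟨shrinkYonedaEquiv.symm (β.app (op ⟨X, hX⟩) (shrinkYonedaObjObjEquiv.symm (𝟙 X))),
        ?_, ?_⟩
      · ext ⟨⟨Z, ⟨⟩⟩⟩ f
        obtain ⟨f, rfl⟩ := shrinkYonedaObjObjEquiv.symm.surjective f
        let f' : (⟨X, hX⟩ : (ObjectProperty.ofObj (fun _ : PUnit.{w+1} => X)).FullSubcategory) ⟶
          ⟨X, hX⟩ := ObjectProperty.homMk f
        have := β.naturality_apply f'.op (shrinkYonedaObjObjEquiv.symm (𝟙 X))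
        have h2 := shrinkYonedaEquiv_symm_app_shrinkYonedaObjObjEquiv_symm
          (P := ψ) (β.app (op ⟨X, hX⟩) (shrinkYonedaObjObjEquiv.symm (𝟙 X))) f
        refine h2.trans (this.symm.trans (congrArg (β.app (op ⟨X, hX⟩)) ?_))
        exact (shrinkYoneda_obj_map_shrinkYonedaObjObjEquiv_symm f.op (𝟙 X)).trans (by simp)
      · rintro γ rfl
        apply shrinkYonedaEquiv.injective
        simp
        rfl)
  exact ⟨isPointwiseLeftKanExtensionOfIsLeftKanExtension _ _⟩

theorem isSmall_iff_essImage (L : ObjectProperty C) [ObjectProperty.EssentiallySmall.{w} L]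
    (φ : Cᵒᵖ ⥤ Type w) :
    Nonempty ((LeftExtension.mk φ (𝟙 (L.ι.op ⋙ φ)) :
      L.ι.op.LeftExtension (L.ι.op ⋙ φ)).IsPointwiseLeftKanExtension) ↔
    (L.ι.op.lan (H := Type w)).essImage φ := by
  have := (L.ι.op.lanAdjunction (Type w)).fullyFaithfulLOfIsIsoUnit.full
  have := (L.ι.op.lanAdjunction (Type w)).fullyFaithfulLOfIsIsoUnit.faithful
  rw [← Adjunction.isIso_counit_app_iff_mem_essImage (L.ι.op.lanAdjunction (Type w)),
    isIso_lanAdjunction_counit_app_iff]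
  exact ⟨fun ⟨h⟩ => h.isLeftKanExtension,
    fun _ => ⟨isPointwiseLeftKanExtensionOfIsLeftKanExtension _ _⟩⟩

theorem essImage_mono {L L' : ObjectProperty C} [ObjectProperty.EssentiallySmall.{w} L]
    [ObjectProperty.EssentiallySmall.{w} L'] (h : L ≤ L') :
    (L.ι.op.lan (H := Type w)).essImage ≤ (L'.ι.op.lan (H := Type w)).essImage := by
  have (F : L.FullSubcategoryᵒᵖ ⥤ Type w) :
      (ObjectProperty.ιOfLE h).op.HasPointwiseLeftKanExtension F := by
    intro c
    have := hasColimitsOfShape_of_essentiallySmall.{w}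
      (CostructuredArrow (ObjectProperty.ιOfLE h).op c) (Type w)
    infer_instance
  let e : L.ι.op.lan (H := Type w) ≅ (ObjectProperty.ιOfLE h).op.lan ⋙ L'.ι.op.lan :=
    Adjunction.leftAdjointUniq (L.ι.op.lanAdjunction (Type w))
      (((ObjectProperty.ιOfLE h).op.lanAdjunction (Type w)).comp
        (L'.ι.op.lanAdjunction (Type w)))
  rintro φ ⟨F, ⟨i⟩⟩
  exact ⟨_, ⟨(e.app F).symm ≪≫ i⟩⟩

instance (J : Type w) [SmallCategory J] :
    (IsSmallPresheaf.{w} (C := C)).IsClosedUnderColimitsOfShape J where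
  colimitsOfShape_le := by
    rintro φ ⟨p⟩
    choose L hL h using p.prop_diag_obj
    have : (⨆ j, L j).EssentiallySmall := inferInstance
    refine ⟨⨆ j, L j, inferInstance, ?_⟩
    have := ((⨆ j, L j).ι.op.lanAdjunction (Type w)).fullyFaithfulLOfIsIsoUnit.full
    have := ((⨆ j, L j).ι.op.lanAdjunction (Type w)).fullyFaithfulLOfIsIsoUnit.faithful
    have := ((⨆ j, L j).ι.op.lanAdjunction (Type w)).isLeftAdjoint
    rw [isSmall_iff_essImage]
    refine ObjectProperty.prop_of_isColimit _ p.isColimit (fun j => ?_)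
    exact essImage_mono (le_iSup L j) _ ((isSmall_iff_essImage (L j) _).1 (h j))

instance : HasColimitsOfSize.{w, w} (SmallPresheaf.{w} C) where
  has_colimits_of_shape _ _ := inferInstance

instance : PreservesColimitsOfSize.{w, w} (IsSmallPresheaf.{w} (C := C)).ι where
  preservesColimitsOfShape := inferInstance


variable (C) in
/-- The Yoneda embedding of `C` into the category of small presheaves. -/
noncomputable def yo : C ⥤ SmallPresheaf.{w} C :=
  (IsSmallPresheaf.{w} (C := C)).lift shrinkYoneda.{w} isSmallPresheaf_shrinkYoneda

/-- The Yoneda embedding is fully faithful. -/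
noncomputable def fullyFaithfulYo : (yo.{w} C).FullyFaithful where
  preimage f := (fullyFaithfulShrinkYoneda C).preimage f.hom
  map_preimage f := by
    apply ObjectProperty.hom_ext
    exact (fullyFaithfulShrinkYoneda C).map_preimage f.hom
  preimage_map f := (fullyFaithfulShrinkYoneda C).preimage_map f

instance : (yo.{w} C).Full := fullyFaithfulYo.full
instance : (yo.{w} C).Faithful := fullyFaithfulYo.faithful

/-- The Yoneda lemma for small presheaves. -/
noncomputable def yoEquiv {X : C} {φ : SmallPresheaf.{w} C} : ((yo C).obj X ⟶ φ) ≃ φ.obj.obj (op X) :=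
  (InducedCategory.homEquiv).trans shrinkYonedaEquiv

theorem yoEquiv_comp {X : C} {φ ψ : SmallPresheaf.{w} C} (a : (yo C).obj X ⟶ φ) (f : φ ⟶ ψ) :
    yoEquiv (a ≫ f) = f.hom.app _ (yoEquiv a) :=
  shrinkYonedaEquiv_comp _ _

theorem yoEquiv_naturality {X Y : C} {φ : SmallPresheaf.{w} C} (g : Y ⟶ X) (a : (yo C).obj X ⟶ φ) :
    yoEquiv ((yo C).map g ≫ a) = φ.obj.map g.op (yoEquiv a) :=
  (shrinkYonedaEquiv_naturality a.hom g).symm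

theorem yoEquiv_symm_naturality {X Y : C} {φ : SmallPresheaf.{w} C} (g : Y ⟶ X) (x : φ.obj.obj (op X)) :
    yoEquiv.symm (φ.obj.map g.op x) = (yo C).map g ≫ yoEquiv.symm x := by
  apply yoEquiv.injective
  simp [yoEquiv_naturality]

instance : (yo.{w} C).IsDense where
  isDenseAt φ := ⟨{
    desc s := ObjectProperty.homMk
      { app c := ↾fun x => yoEquiv (s.ι.app (CostructuredArrow.mk (yoEquiv.symm x :
          (yo C).obj c.unop ⟶ φ)))
        naturality c d f := by
          ext x
          have := s.w (CostructuredArrow.homMk f.unop (yoEquiv_symm_naturality f.unop x).symm :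
            CostructuredArrow.mk (yoEquiv.symm (φ.obj.map f x) : (yo C).obj d.unop ⟶ φ) ⟶
            CostructuredArrow.mk (yoEquiv.symm x : (yo C).obj c.unop ⟶ φ))
          exact (congrArg yoEquiv this).symm.trans (yoEquiv_naturality f.unop _) }
    fac s j := by
      apply yoEquiv.injective
      refine (yoEquiv_comp _ _).trans ?_
      change yoEquiv (s.ι.app (CostructuredArrow.mk (yoEquiv.symm (yoEquiv (𝟙 _ ≫ j.hom))))) = _
      rw [Equiv.symm_apply_apply, Category.id_comp]
      rfl
    uniq s m hm := by
      apply ObjectProperty.hom_ext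
      ext c x
      have := hm (CostructuredArrow.mk (yoEquiv.symm x : (yo C).obj c.unop ⟶ φ))
      refine Eq.trans ?_ (congrArg yoEquiv this)
      refine Eq.trans ?_ (yoEquiv_comp _ _).symm
      refine congrArg (m.hom.app c) ?_
      exact ((congrArg yoEquiv (Category.id_comp _)).trans (Equiv.apply_symm_apply _ _)).symm }⟩

/-- An element `y` of `φ` at an object of `L`, and a morphism carrying it to a given element. -/
noncomputable def preObj {φ : SmallPresheaf.{w} C} {L : ObjectProperty C} (X : CostructuredArrow (yo.{w} C) φ)
    (g : CostructuredArrow L.ι.op (op X.left)) (y : φ.obj.obj (op g.left.unop.obj))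
    (hy : φ.obj.map g.hom y = yoEquiv X.hom) :
    StructuredArrow X (CostructuredArrow.pre L.ι (yo.{w} C) φ) :=
  StructuredArrow.mk (Y := CostructuredArrow.mk (S := L.ι ⋙ yo.{w} C) (Y := g.left.unop)
    (yoEquiv.symm y)) (CostructuredArrow.homMk g.hom.unop (by
      apply yoEquiv.injective
      refine (yoEquiv_naturality _ _).trans ?_
      refine Eq.trans ?_ hy
      exact congrArg (φ.obj.map g.hom) (Equiv.apply_symm_apply yoEquiv y)))

theorem preObj_surjective {φ : SmallPresheaf.{w} C} {L : ObjectProperty C}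
    (X : CostructuredArrow (yo.{w} C) φ)
    (o : StructuredArrow X (CostructuredArrow.pre L.ι (yo.{w} C) φ)) :
    ∃ g y hy, o = preObj X g y hy := by
  obtain ⟨⟨⟨⟩⟩, ⟨l, ⟨⟨⟩⟩, b⟩, f⟩ := o
  obtain ⟨y, rfl⟩ := yoEquiv.symm.surjective b
  refine ⟨CostructuredArrow.mk (S := L.ι.op) (Y := op l) f.left.op, y, ?_, rfl⟩
  have := congrArg yoEquiv (CostructuredArrow.w f)
  refine Eq.trans ?_ this
  refine Eq.trans ?_ (yoEquiv_naturality _ _).symm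
  exact congrArg (φ.obj.map f.left.op) (Equiv.apply_symm_apply yoEquiv y).symm

/-- The category of elements of a small presheaf has a final essentially small subcategory. -/
theorem final_pre (φ : SmallPresheaf.{w} C) (L : ObjectProperty C)
    (h : (LeftExtension.mk φ.obj (𝟙 (L.ι.op ⋙ φ.obj)) :
      L.ι.op.LeftExtension (L.ι.op ⋙ φ.obj)).IsPointwiseLeftKanExtension) :
    (CostructuredArrow.pre L.ι (yo.{w} C) φ).Final where
  out X := by
    have hc := h (op X.left)
    have : Nonempty (StructuredArrow X (CostructuredArrow.pre L.ι (yo.{w} C) φ)) := by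
      obtain ⟨g, y, hy⟩ := Types.jointly_surjective_of_isColimit hc (yoEquiv X.hom)
      exact ⟨preObj X g y hy⟩
    apply zigzag_isConnected
    intro o₀ o₁
    let q : Cocone (CostructuredArrow.proj L.ι.op (op X.left) ⋙ L.ι.op ⋙ φ.obj) :=
      { pt := ULift.{w} Prop
        ι :=
          { app g := ↾fun y => ⟨∃ hy, Zigzag o₀ (preObj X g y hy)⟩
            naturality g g' m := by
              ext y
              have hm : φ.obj.map g'.hom (φ.obj.map m.left.unop.hom.op y) = φ.obj.map g.hom y := by
                refine (ConcreteCategory.congr_hom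
                  (φ.obj.map_comp m.left.unop.hom.op g'.hom) y).symm.trans ?_
                exact ConcreteCategory.congr_hom (congrArg φ.obj.map (CostructuredArrow.w m)) y
              have key : ∀ hy hy', Zigzag (preObj X g' (φ.obj.map m.left.unop.hom.op y) hy')
                  (preObj X g y hy) := fun hy hy' => by
                refine Zigzag.of_hom (StructuredArrow.homMk (CostructuredArrow.homMk m.left.unop
                  ?_) ?_)
                · exact (yoEquiv_symm_naturality _ _).symm
                · ext
                  exact congrArg Quiver.Hom.unop (CostructuredArrow.w m)
              apply ULift.ext
              apply propext
              constructor
              · rintro ⟨hy, z⟩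
                exact ⟨hm.symm.trans hy, z.trans (key _ _)⟩
              · rintro ⟨hy, z⟩
                exact ⟨hm.trans hy, z.trans (zigzag_symm.symm _ _ (key _ _))⟩ } }
    obtain ⟨g₀, y₀, hy₀, h₀⟩ := preObj_surjective X o₀
    obtain ⟨g₁, y₁, hy₁, h₁⟩ := preObj_surjective X o₁
    have e₀ := ConcreteCategory.congr_hom (hc.fac q g₀) y₀
    have e₁ := ConcreteCategory.congr_hom (hc.fac q g₁) y₁
    have hx : hc.desc q (φ.obj.map g₀.hom y₀) = hc.desc q (φ.obj.map g₁.hom y₁) := by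
      rw [hy₀, hy₁]
    have e : q.ι.app g₀ y₀ = q.ι.app g₁ y₁ := e₀.symm.trans (hx.trans e₁)
    have t₀ : (q.ι.app g₀ y₀).down := ⟨hy₀, by rw [← h₀]⟩
    rw [e] at t₀
    obtain ⟨_, z⟩ := t₀
    rw [h₁]
    exact z

instance (φ : SmallPresheaf.{w} C) : FinallySmall.{w} (CostructuredArrow (yo.{w} C) φ) := by
  obtain ⟨L, _, ⟨h⟩⟩ := φ.property
  have := final_pre φ L h
  exact finallySmall_of_final_of_essentiallySmall (CostructuredArrow.pre L.ι (yo.{w} C) φ)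

section

variable {D : Type u'} [Category.{v'} D]

instance [HasColimitsOfSize.{w, w} D] (F : C ⥤ D) :
    (yo.{w} C).HasPointwiseLeftKanExtension F := fun φ => by
  have := hasColimitsOfShape_of_finallySmall.{w} (CostructuredArrow (yo.{w} C) φ) D
  infer_instance

instance isLeftKanExtension_id (G : SmallPresheaf.{w} C ⥤ D) [PreservesColimitsOfSize.{w, w} G] :
    G.IsLeftKanExtension (𝟙 (yo.{w} C ⋙ G)) := by
  have h : (LeftExtension.mk G (𝟙 (yo.{w} C ⋙ G)) :
      (yo.{w} C).LeftExtension (yo.{w} C ⋙ G)).IsPointwiseLeftKanExtension := fun φ => by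
    have : PreservesColimitsOfShape (CostructuredArrow (yo.{w} C) φ) G :=
      Final.preservesColimitsOfShape_of_final (fromFinalModel.{w} _) _
    exact (isColimitOfPreserves G ((yo.{w} C).denseAt φ)).ofIsoColimit
      (Cocone.ext (Iso.refl _) (fun j => by
        refine (Category.comp_id _).trans ?_
        refine (G.map_comp _ _).trans ?_
        exact congrArg (· ≫ G.map j.hom) (G.map_id _)))
  exact h.isLeftKanExtension


/-- The maps out of the value of a left Kan extension along `yo`. -/
noncomputable def lanHomEquiv [LocallySmall.{w} D] {F : C ⥤ D} {E : (yo.{w} C).LeftExtension F}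
    (hE : E.IsPointwiseLeftKanExtension) (φ : SmallPresheaf.{w} C) (d : D) :
    (E.right.obj φ ⟶ d) ≃ (φ.obj ⟶ F.op ⋙ shrinkYoneda.{w}.obj d) where
  toFun k :=
    { app c := ↾fun x => shrinkYonedaObjObjEquiv.symm
        (E.hom.app c.unop ≫ E.right.map (yoEquiv.symm x) ≫ k)
      naturality c c' f := by
        ext x
        apply shrinkYonedaObjObjEquiv.injective
        refine (Equiv.apply_symm_apply _ _).trans ?_
        refine Eq.trans ?_ (shrinkYonedaObjObjEquiv_obj_map _ _).symm
        refine Eq.trans ?_ (congrArg (F.map f.unop ≫ ·) (Equiv.apply_symm_apply _ _)).symm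
        have := yoEquiv_symm_naturality f.unop x
        have h2 := E.hom.naturality f.unop
        dsimp at h2
        refine (congrArg (fun a => E.hom.app c'.unop ≫ E.right.map a ≫ k) this).trans ?_
        refine Eq.trans ?_ (congrArg (F.map f.unop ≫ ·) rfl)
        simp [reassoc_of% h2] }
  invFun t := (hE φ).desc
    { pt := d
      ι :=
        { app j := shrinkYonedaObjObjEquiv (t.app (op j.left) (yoEquiv j.hom))
          naturality j j' f := by
            have h1 := yoEquiv_naturality f.left j'.hom
            rw [CostructuredArrow.w f] at h1
            have h2 := shrinkYonedaObjObjEquiv_obj_map (F.map f.left).op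
              (t.app (op j'.left) (yoEquiv j'.hom))
            have h3 := t.naturality_apply f.left.op (yoEquiv j'.hom)
            refine Eq.trans ?_ (Category.comp_id _).symm
            refine h2.symm.trans ?_
            refine congrArg shrinkYonedaObjObjEquiv ?_
            rw [h1]
            exact h3.symm } }
  left_inv k := (hE φ).hom_ext (fun j => by
    refine ((hE φ).fac _ j).trans ?_
    refine (Equiv.apply_symm_apply _ _).trans ?_
    rw [Equiv.symm_apply_apply]
    exact (Category.assoc _ _ _).symm)
  right_inv t := by
    ext c x
    apply shrinkYonedaObjObjEquiv.injective
    refine (Equiv.apply_symm_apply _ _).trans ?_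
    refine (Category.assoc _ _ _).symm.trans ?_
    refine ((hE φ).fac _ (CostructuredArrow.mk (yoEquiv.symm x))).trans ?_
    exact congrArg (fun y => shrinkYonedaObjObjEquiv (t.app c y)) (Equiv.apply_symm_apply _ _)

theorem lanHomEquiv_naturality [LocallySmall.{w} D] {F : C ⥤ D}
    {E : (yo.{w} C).LeftExtension F} (hE : E.IsPointwiseLeftKanExtension) {φ ψ : SmallPresheaf.{w} C} (d : D)
    (f : φ ⟶ ψ) (k : E.right.obj ψ ⟶ d) :
    lanHomEquiv hE φ d (E.right.map f ≫ k) = f.hom ≫ lanHomEquiv hE ψ d k := by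
  ext c x
  apply shrinkYonedaObjObjEquiv.injective
  refine (Equiv.apply_symm_apply _ _).trans ?_
  refine Eq.trans ?_ (Equiv.apply_symm_apply _ _).symm
  have : (yoEquiv.symm (f.hom.app c x) : (yo C).obj c.unop ⟶ ψ) = yoEquiv.symm x ≫ f := by
    apply yoEquiv.injective
    rw [yoEquiv_comp, Equiv.apply_symm_apply, Equiv.apply_symm_apply]
  refine Eq.trans ?_ (congrArg (fun a => E.hom.app c.unop ≫ E.right.map a ≫ k) this.symm)
  simp

theorem preservesColimits_of_isPointwise [LocallySmall.{w} D] {F : C ⥤ D}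
    {E : (yo.{w} C).LeftExtension F} (hE : E.IsPointwiseLeftKanExtension) :
    PreservesColimitsOfSize.{w, w} E.right where
  preservesColimitsOfShape {J _} := ⟨fun {K} => ⟨fun {c} hc => ⟨by
    have hc' := isColimitOfPreserves (IsSmallPresheaf.{w} (C := C)).ι hc
    let q (s : Cocone (K ⋙ E.right)) : Cocone (K ⋙ (IsSmallPresheaf.{w} (C := C)).ι) :=
      { pt := F.op ⋙ shrinkYoneda.{w}.obj s.pt
        ι :=
          { app j := lanHomEquiv hE (K.obj j) s.pt (s.ι.app j)
            naturality j j' f := by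
              refine Eq.trans ?_ (Category.comp_id _).symm
              refine (lanHomEquiv_naturality hE s.pt (K.map f) (s.ι.app j')).symm.trans ?_
              exact congrArg _ (s.w f) } }
    exact
      { desc s := (lanHomEquiv hE c.pt s.pt).symm (hc'.desc (q s))
        fac s j := by
          apply (lanHomEquiv hE (K.obj j) s.pt).injective
          refine (lanHomEquiv_naturality hE s.pt (c.ι.app j) _).trans ?_
          refine Eq.trans ?_ (hc'.fac (q s) j)
          exact congrArg ((c.ι.app j).hom ≫ ·) (Equiv.apply_symm_apply _ _)
        uniq s m hm := by
          apply (lanHomEquiv hE c.pt s.pt).injective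
          rw [Equiv.apply_symm_apply]
          refine hc'.uniq (q s) _ (fun j => ?_)
          refine (lanHomEquiv_naturality hE s.pt (c.ι.app j) m).symm.trans ?_
          exact congrArg _ (hm j) }⟩⟩⟩

instance [HasColimitsOfSize.{w, w} D] [LocallySmall.{w} D] (F : C ⥤ D) :
    PreservesColimitsOfSize.{w, w} ((yo.{w} C).lan.obj F) :=
  preservesColimits_of_isPointwise
    (isPointwiseLeftKanExtensionOfIsLeftKanExtension _ ((yo.{w} C).lanUnit.app F))

/-- Cocontinuous functors on `P C` are determined up to isomorphism by their restrictions to `C`: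
`extIso e` is the unique isomorphism which restricts to `e`. -/
noncomputable def extIso {G G' : SmallPresheaf.{w} C ⥤ D} [PreservesColimitsOfSize.{w, w} G]
    [PreservesColimitsOfSize.{w, w} G'] (e : yo.{w} C ⋙ G ≅ yo.{w} C ⋙ G') : G ≅ G' :=
  G.leftKanExtensionUniqueOfIso (𝟙 (yo.{w} C ⋙ G)) e G' (𝟙 (yo.{w} C ⋙ G'))

theorem whiskerLeft_extIso {G G' : SmallPresheaf.{w} C ⥤ D} [PreservesColimitsOfSize.{w, w} G]
    [PreservesColimitsOfSize.{w, w} G'] (e : yo.{w} C ⋙ G ≅ yo.{w} C ⋙ G') :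
    whiskerLeft (yo.{w} C) (extIso e).hom = e.hom := by
  have := G.descOfIsLeftKanExtension_fac (𝟙 (yo.{w} C ⋙ G)) G' (e.hom ≫ 𝟙 (yo.{w} C ⋙ G'))
  exact (Category.id_comp _).symm.trans (this.trans (Category.comp_id _))

end

/-! ### The pseudomonad of small presheaves

The data of the pseudomonad: the action on functors and on natural transformations, the unit `yo`,
the multiplication `mul`, and the invertible structure 2-cells. All of the functors involved are
cocontinuous, and each structure 2-cell is the unique one which restricts, along the Yoneda
embedding, to the evident isomorphism built from the units of the Kan extensions. -/

section

variable {D : Type u'} [Category.{v'} D] [LocallySmall.{w} D]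
variable {E : Type u''} [Category.{v''} E] [LocallySmall.{w} E]

/-- The action on functors: `map F` is the left Kan extension of `F ⋙ yo D` along `yo C`, that is,
the cocontinuous extension of `F ⋙ yo D`. -/
noncomputable def map (F : C ⥤ D) : SmallPresheaf.{w} C ⥤ SmallPresheaf.{w} D :=
  (yo.{w} C).lan.obj (F ⋙ yo.{w} D)

instance (F : C ⥤ D) : PreservesColimitsOfSize.{w, w} (map.{w} F) :=
  inferInstanceAs (PreservesColimitsOfSize.{w, w} ((yo.{w} C).lan.obj (F ⋙ yo.{w} D)))

/-- The action on natural isomorphisms. -/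
noncomputable def mapIso {F G : C ⥤ D} (α : F ≅ G) : map.{w} F ≅ map.{w} G :=
  (yo.{w} C).lan.mapIso (isoWhiskerRight α (yo.{w} D))

/-- Pseudonaturality of the unit. -/
noncomputable def yoNat (F : C ⥤ D) : F ⋙ yo.{w} D ≅ yo.{w} C ⋙ map.{w} F :=
  (asIso ((yo.{w} C).lanUnit.app (F ⋙ yo.{w} D)) :)

variable (C) in
/-- Compatibility with identities. -/
noncomputable def mapId : map.{w} (𝟭 C) ≅ 𝟭 (SmallPresheaf.{w} C) :=
  extIso ((yoNat.{w} (𝟭 C)).symm ≪≫ Functor.leftUnitor _ ≪≫ (Functor.rightUnitor _).symm)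

/-- Compatibility with composition. -/
noncomputable def mapComp (F : C ⥤ D) (G : D ⥤ E) : map.{w} (F ⋙ G) ≅ map.{w} F ⋙ map.{w} G :=
  extIso ((yoNat.{w} (F ⋙ G)).symm ≪≫ Functor.associator _ _ _ ≪≫ isoWhiskerLeft F (yoNat.{w} G) ≪≫
    (Functor.associator _ _ _).symm ≪≫ isoWhiskerRight (yoNat.{w} F) (map.{w} G) ≪≫ Functor.associator _ _ _)

variable (C) in
/-- The multiplication: the cocontinuous extension of the identity functor. -/
noncomputable def mul : SmallPresheaf.{w} (SmallPresheaf.{w} C) ⥤ SmallPresheaf.{w} C :=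
  (yo.{w} (SmallPresheaf.{w} C)).lan.obj (𝟭 (SmallPresheaf.{w} C))

instance : PreservesColimitsOfSize.{w, w} (mul.{w} C) :=
  inferInstanceAs (PreservesColimitsOfSize.{w, w}
    ((yo.{w} (SmallPresheaf.{w} C)).lan.obj (𝟭 (SmallPresheaf.{w} C))))

variable (C) in
/-- The first unit law. -/
noncomputable def yoMul : yo.{w} (SmallPresheaf.{w} C) ⋙ mul.{w} C ≅ 𝟭 (SmallPresheaf.{w} C) :=
  (asIso ((yo.{w} (SmallPresheaf.{w} C)).lanUnit.app (𝟭 (SmallPresheaf.{w} C)))).symm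

variable (C) in
/-- The second unit law. -/
noncomputable def mapYoMul : map.{w} (yo.{w} C) ⋙ mul.{w} C ≅ 𝟭 (SmallPresheaf.{w} C) :=
  extIso ((Functor.associator _ _ _).symm ≪≫ isoWhiskerRight (yoNat.{w} (yo.{w} C)).symm (mul.{w} C) ≪≫
    Functor.associator _ _ _ ≪≫ isoWhiskerLeft (yo.{w} C) (yoMul.{w} C))

/-- Pseudonaturality of the multiplication. -/
noncomputable def mulNat (F : C ⥤ D) : map.{w} (map.{w} F) ⋙ mul.{w} D ≅ mul.{w} C ⋙ map.{w} F :=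
  extIso ((Functor.associator _ _ _).symm ≪≫ isoWhiskerRight (yoNat.{w} (map.{w} F)).symm (mul.{w} D) ≪≫
    Functor.associator _ _ _ ≪≫ isoWhiskerLeft (map.{w} F) (yoMul.{w} D) ≪≫ Functor.rightUnitor _ ≪≫
    (Functor.leftUnitor _).symm ≪≫ isoWhiskerRight (yoMul.{w} C).symm (map.{w} F) ≪≫ Functor.associator _ _ _)

variable (C) in
/-- Associativity of the multiplication. -/
noncomputable def mulAssoc :
    map.{w} (mul.{w} C) ⋙ mul.{w} C ≅ mul.{w} (SmallPresheaf.{w} C) ⋙ mul.{w} C :=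
  extIso ((Functor.associator _ _ _).symm ≪≫ isoWhiskerRight (yoNat.{w} (mul.{w} C)).symm (mul.{w} C) ≪≫
    Functor.associator _ _ _ ≪≫ isoWhiskerLeft (mul.{w} C) (yoMul.{w} C) ≪≫ Functor.rightUnitor _ ≪≫
    (Functor.leftUnitor _).symm ≪≫ isoWhiskerRight (yoMul.{w} (SmallPresheaf.{w} C)).symm (mul.{w} C) ≪≫
    Functor.associator _ _ _)

end

variable (C) in
/-- A pseudoalgebra structure on `C` for the pseudomonad of small presheaves: an action, invertible
unit and associativity 2-cells, and the two coherence axioms for them (the remaining compatibility,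
of `assocIso` with `yo` of `SmallPresheaf C`, is a consequence of these two). -/
structure Pseudoalgebra where
  /-- the action -/
  act : SmallPresheaf.{w} C ⥤ C
  /-- the unit 2-cell -/
  unitIso : yo.{w} C ⋙ act ≅ 𝟭 C
  /-- the associativity 2-cell -/
  assocIso : map.{w} act ⋙ act ≅ mul.{w} C ⋙ act
  /-- the unit axiom: both composites go from `map (yo C) ⋙ map act ⋙ act` to `act` -/
  unit_coherence :
    isoWhiskerLeft (map.{w} (yo.{w} C)) assocIso ≪≫ (Functor.associator _ _ _).symm ≪≫
        isoWhiskerRight (mapYoMul.{w} C) act ≪≫ Functor.leftUnitor act =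
      (Functor.associator _ _ _).symm ≪≫ isoWhiskerRight (mapComp.{w} (yo.{w} C) act).symm act ≪≫
        isoWhiskerRight (mapIso.{w} unitIso) act ≪≫ isoWhiskerRight (mapId.{w} C) act ≪≫
        Functor.leftUnitor act
  /-- the associativity axiom: both composites go from `map (map act) ⋙ map act ⋙ act` to
  `mul (SmallPresheaf C) ⋙ mul C ⋙ act` -/
  assoc_coherence :
    (Functor.associator _ _ _).symm ≪≫ isoWhiskerRight (mapComp.{w} (map.{w} act) act).symm act ≪≫
        isoWhiskerRight (mapIso.{w} assocIso) act ≪≫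
        isoWhiskerRight (mapComp.{w} (mul.{w} C) act) act ≪≫ Functor.associator _ _ _ ≪≫
        isoWhiskerLeft (map.{w} (mul.{w} C)) assocIso ≪≫ (Functor.associator _ _ _).symm ≪≫
        isoWhiskerRight (mulAssoc.{w} C) act ≪≫ Functor.associator _ _ _ =
      isoWhiskerLeft (map.{w} (map.{w} act)) assocIso ≪≫ (Functor.associator _ _ _).symm ≪≫
        isoWhiskerRight (mulNat.{w} act) act ≪≫ Functor.associator _ _ _ ≪≫
        isoWhiskerLeft (mul.{w} (SmallPresheaf.{w} C)) assocIso

variable (C) in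
/-- A pseudoalgebra structure on the finitely complete category `C` for the lifting of the
pseudomonad of small presheaves to the 2-category of finitely complete categories, left exact
functors and all natural transformations. Since that 2-category is locally full in the 2-category
of categories, this is a pseudoalgebra structure whose action is left exact. -/
structure LexPseudoalgebra [HasFiniteLimits C] extends Pseudoalgebra.{w} C where
  /-- the action preserves finite limits -/
  lex : PreservesFiniteLimits act

variable (C) in
/-- The Yoneda embedding of `C` into small presheaves has a left exact left adjoint. -/
def HasLexReflector [HasFiniteLimits C] : Prop :=
  ∃ L : SmallPresheaf.{w} C ⥤ C, Nonempty (L ⊣ yo.{w} C) ∧ PreservesFiniteLimits L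

end LexCocompletion

/-- An `∞`-pretopos, relative to the universe `w` of small sets: finite limits, small colimits
which are stable under pullback, disjoint coproducts, and effective equivalence relations. -/
structure IsInftyPretopos (C : Type u) [Category.{v} C] : Prop where
  hasFiniteLimits : HasFiniteLimits C
  hasColimits : HasColimitsOfSize.{w, w} C
  universal : ∀ (J : Type w) [SmallCategory J] (F : J ⥤ C) (c : Cocone F),
    IsColimit c → IsUniversalColimit c
  disjoint : ∀ (ι : Type w), CoproductsOfShapeDisjoint C ι
  effective : ∀ (R X : C) (p₁ p₂ : R ⟶ X), IsEquivalenceRelation p₁ p₂ →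
    IsEffectiveEquivalenceRelation p₁ p₂

/-! The two equivalences come from four implications, written for the reflector `L` of `yo`.

From an ∞-pretopos to a lex reflector: cocompleteness makes the left Kan extension `L` of the
identity along `yo` a left adjoint, and only its left exactness is at issue. Use the canonical
topology. Stability of colimits says that the legs of a colimit cocone cover. Disjointness then
makes sheaves turn coproducts into products. For a coequalizer of `f, g`, the generated equivalence
relation is the image of all zigzags in the graph `f, g`; it is effective, so it contains the kernel
pair of the coequalizer, and it is covered by zigzags, so a section that equalizes `f, g` equalizes
the kernel pair and descends. Hence the Yoneda embedding into sheaves is cocontinuous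
(`preservesColimits_uliftYoneda`). Sheafification on small presheaves and `L` followed by this
embedding are both cocontinuous and agree on representables, so they are isomorphic. Sheafification
is left exact and the embedding is fully faithful, so `L` is left exact.

From a lex reflector to an ∞-pretopos: small presheaves have pointwise small colimits and limits, so
stability, disjointness and the effectiveness needed come from sets. Every small colimit in `C` is
the image under `L` of one between small presheaves, and `L` preserves colimits and finite limits.

From a pseudoalgebra to a reflector: the action is shown to be left adjoint to `yo`. The
multiplication inverts the comparison from `map yo` to `yo`, and associativity transports this to
the action. It follows that maps out of `act φ` are determined on representables over `φ`
(`act_hom_ext`), where the triangle identities are immediate.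

From a reflector to a pseudoalgebra: a left adjoint is cocontinuous, so the associativity cell and
its coherence are determined on representables. -/

namespace CategoryTheory

/-! ### Universal colimits and the canonical topology -/

section

variable {C : Type u} [Category.{v} C]

/-- A leg of a cocone. -/
def Limits.Cocone.leg {J : Type u'} [Category.{v'} J] {F : J ⥤ C} (c : Cocone F) (j : J) :
    F.obj j ⟶ c.pt := c.ι.app j

@[simp]
theorem Limits.Cocone.w_leg {J : Type u'} [Category.{v'} J] {F : J ⥤ C} (c : Cocone F) {i j : J}
    (m : i ⟶ j) : F.map m ≫ c.leg j = c.leg i := c.w m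

/-- The diagram of pullbacks, along a morphism into the point of a cocone, of its legs. -/
noncomputable abbrev Limits.Cocone.pullbackDiagram [HasPullbacks C] {J : Type u'} [Category.{v'} J]
    {F : J ⥤ C} (c : Cocone F) {Y : C} (f : Y ⟶ c.pt) : J ⥤ C where
  obj j := pullback f (c.leg j)
  map {i j} m := pullback.lift (pullback.fst _ _) (pullback.snd _ _ ≫ F.map m)
    (by simp [pullback.condition])
  map_id _ := by apply pullback.hom_ext <;> simp
  map_comp f g := by apply pullback.hom_ext <;>
    simp [pullback.lift_fst, pullback.lift_snd, pullback.lift_snd_assoc]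

section

variable [HasPullbacks C] {J : Type u'} [Category.{v'} J] {F : J ⥤ C} (c : Cocone F) {Y : C}
  (f : Y ⟶ c.pt) {i j : J} (m : i ⟶ j)

theorem Limits.Cocone.pullbackDiagram_map_fst :
    (c.pullbackDiagram f).map m ≫ pullback.fst f (c.leg j) = pullback.fst f (c.leg i) :=
  pullback.lift_fst _ _ _

theorem Limits.Cocone.pullbackDiagram_map_snd :
    (c.pullbackDiagram f).map m ≫ pullback.snd f (c.leg j) =
      pullback.snd f (c.leg i) ≫ F.map m :=
  pullback.lift_snd _ _ _

end

/-- The pullback of a cocone along a morphism into its point. -/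
@[simps]
noncomputable def Limits.Cocone.pullbackAlong [HasPullbacks C] {J : Type u'} [Category.{v'} J]
    {F : J ⥤ C} (c : Cocone F) {Y : C} (f : Y ⟶ c.pt) : Cocone (c.pullbackDiagram f) where
  pt := Y
  ι := { app := fun _ => pullback.fst _ _
         naturality := fun _ _ _ => (c.pullbackDiagram_map_fst f _).trans (Category.comp_id _).symm }

theorem IsUniversalColimit.nonempty_isColimit_pullbackAlong [HasPullbacks C] {J : Type u'}
    [Category.{v'} J] {F : J ⥤ C} {c : Cocone F} (hc : IsUniversalColimit c) {Y : C}
    (f : Y ⟶ c.pt) : Nonempty (IsColimit (c.pullbackAlong f)) := by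
  refine hc (c.pullbackAlong f) { app := fun j => pullback.snd _ _, naturality := fun _ _ _ => pullback.lift_snd _ _ _ } f ?_ ?_ ?_
  · ext j
    exact pullback.condition.symm
  · intro i j m
    refine IsPullback.of_right (h₁₂ := pullback.fst f (c.leg j)) (v₁₃ := f) (h₂₂ := c.leg j)
      ?_ ?_ (IsPullback.of_hasPullback f (c.leg j))
    · rw [c.pullbackDiagram_map_fst f m, c.w_leg]
      exact IsPullback.of_hasPullback f (c.leg i)
    · exact c.pullbackDiagram_map_snd f m
  · intro j
    exact IsPullback.of_hasPullback f (c.leg j)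

/-- The legs of a universal colimit cocone cover its point in the canonical topology. -/
theorem IsUniversalColimit.ofArrows_mem_canonicalTopology [HasPullbacks C] {J : Type u'}
    [Category.{v'} J] {F : J ⥤ C} {c : Cocone F} (hc : IsUniversalColimit c) :
    Sieve.ofArrows F.obj c.ι.app ∈ Sheaf.canonicalTopology C c.pt := by
  -- The canonical topology is the finest one for which representables are sheaves, so it suffices
  -- that every pullback of the sieve satisfies the sheaf condition for them; universality makes
  -- each pulled back cocone a colimit.
  refine Sheaf.mem_finestTopology_of_forall_isSheafFor ?_
  rintro _ ⟨Z, rfl⟩ Y f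
  obtain ⟨h⟩ := hc.nonempty_isColimit_pullbackAlong f
  have e : Sieve.ofArrows (c.pullbackDiagram f).obj (c.pullbackAlong f).ι.app =
      Sieve.pullback f (Sieve.ofArrows F.obj c.ι.app) :=
    Sieve.ofArrows_eq_pullback_of_isPullback c.leg
      (fun j => (IsPullback.of_hasPullback f (c.leg j)))
  rw [← e, ← Presieve.isSheafFor_iff_generate]
  refine (Presieve.isSheafFor_arrows_iff (B := Y) (X := (c.pullbackDiagram f).obj)
    (π := fun j => pullback.fst f (c.leg j)) _).2 ?_
  intro x hx
  let s : Cocone (c.pullbackDiagram f) :=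
    { pt := Z, ι := { app := x, naturality := fun i j m => ?_ } }
  · exact ⟨h.desc s, h.fac s, h.uniq s⟩
  -- Compatibility, tested on the transition map against the identity, is naturality of the cocone.
  refine (hx j i _ ((c.pullbackDiagram f).map m) (𝟙 _) ?_).trans ?_
  · exact (c.pullbackDiagram_map_fst f m).trans (Category.id_comp _).symm
  · simp

theorem generate_singleton_mem_canonicalTopology_of_isPullback {A B X Y : C} {f' : A ⟶ B}
    {g' : A ⟶ X} {g : B ⟶ Y} {f : X ⟶ Y} (sq : IsPullback f' g' g f)
    (hf : Sieve.generate (Presieve.singleton f) ∈ Sheaf.canonicalTopology C Y) :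
    Sieve.generate (Presieve.singleton f') ∈ Sheaf.canonicalTopology C B := by
  have := Sieve.ofArrows_eq_pullback_of_isPullback (ι := PUnit.{1}) (fun _ => f)
    (g := g) (p₁ := fun _ => f') (p₂ := fun _ => g') (fun _ => sq)
  rw [Sieve.ofArrows, Sieve.ofArrows, Presieve.ofArrows_pUnit, Presieve.ofArrows_pUnit] at this
  rw [this]
  exact (Sheaf.canonicalTopology C).pullback_stable g hf

theorem effectiveEpi_of_mem_canonicalTopology {X Y : C} {f : X ⟶ Y}
    (hf : Sieve.generate (Presieve.singleton f) ∈ Sheaf.canonicalTopology C Y) : EffectiveEpi f := by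
  rw [← Sieve.effectiveEpimorphic_singleton, Presieve.EffectiveEpimorphic.iff_forall_isSheafFor_yoneda]
  intro Z
  rw [Presieve.isSheafFor_iff_generate]
  exact Sheaf.isSheaf_yoneda_obj Z _ hf

/-- Factoring through a monomorphism is a local property for the canonical topology. -/
theorem exists_factor_of_mem_canonicalTopology {R W Z : C} (i : R ⟶ W) [Mono i] (φ : Z ⟶ W)
    {V : Sieve Z} (hV : V ∈ Sheaf.canonicalTopology C Z)
    (h : ∀ ⦃A : C⦄ (a : A ⟶ Z), V a → ∃ k : A ⟶ R, k ≫ i = a ≫ φ) :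
    ∃ k : Z ⟶ R, k ≫ i = φ := by
  choose k hk using h
  -- The local factorizations are unique because `i` is mono, so they form a compatible family of
  -- sections of the sheaf represented by `R`.
  have hs := Sheaf.isSheaf_yoneda_obj R _ hV
  obtain ⟨t, ht, -⟩ := hs k (by
    intro A₁ A₂ B g₁ g₂ a₁ a₂ h₁ h₂ e
    have e' : g₁ ≫ a₁ = g₂ ≫ a₂ := e
    change g₁ ≫ k a₁ h₁ = g₂ ≫ k a₂ h₂
    rw [← cancel_mono i, Category.assoc, Category.assoc, hk, hk, reassoc_of% e'])
  refine ⟨t, ?_⟩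
  refine (Sheaf.isSheaf_yoneda_obj W _ hV).isSeparatedFor.ext (fun A a ha => ?_)
  change a ≫ t ≫ i = a ≫ φ
  have : a ≫ t = k a ha := ht a ha
  rw [reassoc_of% this, hk]

end

end CategoryTheory

/-! ### Colimit cocones in an ∞-pretopos are covers -/

namespace IsInftyPretopos

variable {C : Type u} [Category.{v} C] (h : IsInftyPretopos.{w} C)
include h

theorem hasPullbacks : HasPullbacks C :=
  have := h.hasFiniteLimits
  inferInstance

/-- The legs of a small colimit cocone cover its point. -/
theorem ofArrows_mem {J : Type w} [SmallCategory J] {F : J ⥤ C} {c : Cocone F} (hc : IsColimit c) :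
    Sieve.ofArrows F.obj c.ι.app ∈ Sheaf.canonicalTopology C c.pt :=
  have := h.hasPullbacks
  (h.universal J F c hc).ofArrows_mem_canonicalTopology

theorem ofArrows_inj_mem {ι : Type w} {X : ι → C} {c : Cofan X} (hc : IsColimit c) :
    Sieve.ofArrows X c.inj ∈ Sheaf.canonicalTopology C c.pt := by
  refine GrothendieckTopology.superset_covering _ ?_ (h.ofArrows_mem hc)
  rw [Sieve.ofArrows, Sieve.generate_le_iff]
  rintro _ _ ⟨⟨i⟩⟩
  exact Sieve.ofArrows_mk X c.inj i

/-- An initial object is an empty coproduct, and coproduct injections cover. Consequently a sheaf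
has at most one section over any object that maps to an initial one. -/
theorem bot_mem {X : C} (hX : IsInitial X) : ⊥ ∈ Sheaf.canonicalTopology C X := by
  let c : Cofan (fun i : PEmpty.{w+1} => (i.elim : C)) := Cofan.mk X (fun i => i.elim)
  have hc : IsColimit c := Cofan.IsColimit.mk _ (fun s => hX.to _) (fun s j => j.elim)
    (fun s m _ => hX.hom_ext _ _)
  refine GrothendieckTopology.superset_covering _ ?_ (h.ofArrows_inj_mem hc)
  rw [Sieve.ofArrows, Sieve.generate_le_iff]
  rintro _ _ ⟨⟨⟩⟩

theorem generate_singleton_mem {A X : C} {f g : A ⟶ X} {c : Cofork f g} (hc : IsColimit c) :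
    Sieve.generate (Presieve.singleton c.π) ∈ Sheaf.canonicalTopology C c.pt := by
  -- Colimits are assumed universal for shapes in `Type w`, so the walking parallel pair is moved to
  -- that universe.
  let e : WalkingParallelPair ≌ AsSmall.{w} WalkingParallelPair := AsSmall.equiv
  have hc' : IsColimit (c.whisker e.inverse) := hc.whiskerEquivalence e.symm
  refine GrothendieckTopology.superset_covering _ ?_ (h.ofArrows_mem hc')
  rw [Sieve.ofArrows, Sieve.generate_le_iff]
  rintro _ _ ⟨⟨⟨⟩⟩⟩
  · change Sieve.generate (Presieve.singleton c.π) (c.ι.app WalkingParallelPair.zero)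
    rw [c.app_zero_eq_comp_π_left]
    exact Sieve.downward_closed _ (Sieve.le_generate _ _ _ ⟨⟩) _
  · exact Sieve.le_generate _ _ _ ⟨⟩

/-- A coequalizer covers by stability; conversely a one-element cover is an effective epimorphism
since representables are sheaves. Covers are stable under pullback, so regular epimorphisms are too.
-/
theorem regularEpi_iff {X Y : C} (f : X ⟶ Y) :
    IsRegularEpi f ↔ Sieve.generate (Presieve.singleton f) ∈ Sheaf.canonicalTopology C Y := by
  have := h.hasPullbacks
  constructor
  · intro hf
    exact h.generate_singleton_mem (IsRegularEpi.isColimit f)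
  · intro hf
    have := effectiveEpi_of_mem_canonicalTopology hf
    infer_instance

theorem hasCoequalizers : HasCoequalizers C :=
  have := h.hasColimits
  have : HasColimitsOfSize.{0, 0} C := hasColimitsOfSizeShrink.{0, 0, w, w} C
  inferInstance

theorem regular : Regular C where
  toHasFiniteLimits := h.hasFiniteLimits
  hasCoequalizer_of_isKernelPair _ :=
    have := h.hasCoequalizers
    inferInstance
  regularEpiIsStableUnderBaseChange := ⟨fun sq hg => by
    refine (h.regularEpi_iff _).2 ?_
    exact generate_singleton_mem_canonicalTopology_of_isPullback sq.flip ((h.regularEpi_iff _).1 hg)⟩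

end IsInftyPretopos

/-! ### Zigzags in a graph -/

namespace CategoryTheory

section

variable {C : Type u} [Category.{v} C]

/-- A span from an object to itself. -/
structure EndoSpan (U : C) where
  /-- the apex -/
  pt : C
  /-- the source -/
  src : pt ⟶ U
  /-- the target -/
  tgt : pt ⟶ U

/-- The shapes of the proofs that two elements are related by the equivalence relation generated
by a pair of morphisms. -/
inductive ZigzagShape : Type
  | rel : ZigzagShape
  | refl : ZigzagShape
  | symm : ZigzagShape → ZigzagShape
  | trans : ZigzagShape → ZigzagShape → ZigzagShape

namespace ZigzagShape

variable [HasPullbacks C] {X U : C} (f g : X ⟶ U)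

/-- The universal zigzag of a given shape in the graph `f, g : X ⟶ U`. -/
noncomputable def span : ZigzagShape → EndoSpan U
  | rel => ⟨X, f, g⟩
  | refl => ⟨U, 𝟙 U, 𝟙 U⟩
  | symm t => ⟨(span t).pt, (span t).tgt, (span t).src⟩
  | trans t t' => ⟨pullback (span t).tgt (span t').src, pullback.fst _ _ ≫ (span t).src,
      pullback.snd _ _ ≫ (span t').tgt⟩

variable {f g}

/-- Induction on the shape; for a concatenation the two halves meet in the middle vertex by the
pullback condition. -/
theorem map_src_eq_map_tgt {P : Cᵒᵖ ⥤ Type u'} {x : P.obj (op U)}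
    (hx : P.map f.op x = P.map g.op x) (t : ZigzagShape) :
    P.map (t.span f g).src.op x = P.map (t.span f g).tgt.op x := by
  induction t with
  | rel => exact hx
  | refl => rfl
  | symm t ih => exact ih.symm
  | trans t t' ih ih' =>
    change P.map (pullback.fst _ _ ≫ (t.span f g).src).op x =
      P.map (pullback.snd _ _ ≫ (t'.span f g).tgt).op x
    rw [op_comp, op_comp, P.map_comp, P.map_comp]
    change P.map _ (P.map _ x) = P.map _ (P.map _ x)
    rw [ih, ← ih']
    change (P.map _ ≫ P.map _) x = (P.map _ ≫ P.map _) x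
    rw [← P.map_comp, ← P.map_comp, ← op_comp, ← op_comp, pullback.condition]

end ZigzagShape

end

end CategoryTheory

/-! ### Generated equivalence relations and sheaves on an ∞-pretopos -/

namespace IsInftyPretopos

variable {C : Type u} [Category.{v} C] (h : IsInftyPretopos.{w} C)
include h

/-- A small family of maps has an image, covered by the family. -/
theorem exists_image {ι : Type w} {S : ι → C} {W : C} (m : ∀ i, S i ⟶ W) :
    ∃ (R : C) (i : R ⟶ W) (e : ∀ t, S t ⟶ R), Mono i ∧ (∀ t, e t ≫ i = m t) ∧
      Sieve.ofArrows S e ∈ Sheaf.canonicalTopology C R := by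
  have := h.hasColimits
  have := h.regular
  let F := Regular.strongEpiMonoFactorisation (Sigma.desc m)
  have hF : Sieve.generate (Presieve.singleton F.e) ∈ Sheaf.canonicalTopology C F.I :=
    (h.regularEpi_iff F.e).1 inferInstance
  refine ⟨F.I, F.m, fun t => Sigma.ι S t ≫ F.e, inferInstance, fun t => ?_, ?_⟩
  · rw [Category.assoc, F.fac, Sigma.ι_desc]
  -- The image is covered by the coproduct, which is covered by its injections.
  · refine GrothendieckTopology.transitive _ hF _ ?_
    rintro _ _ ⟨_, k, _, ⟨⟩, rfl⟩
    rw [Sieve.pullback_comp]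
    apply GrothendieckTopology.pullback_stable
    refine GrothendieckTopology.superset_covering _ ?_
      (h.ofArrows_inj_mem (coproductIsCoproduct S))
    rw [Sieve.ofArrows, Sieve.generate_le_iff]
    rintro _ _ ⟨t⟩
    exact Sieve.ofArrows_mk _ (fun t => Sigma.ι S t ≫ F.e) t

/-- The equivalence relation generated by a pair of morphisms. -/
theorem exists_generatedRelation [HasPullbacks C] {X U : C} (f g : X ⟶ U) :
    ∃ (R : C) (p₁ p₂ : R ⟶ U) (e : ∀ t : ULift.{w} ZigzagShape, (t.down.span f g).pt ⟶ R),
      IsEquivalenceRelation p₁ p₂ ∧ (∀ t, e t ≫ p₁ = (t.down.span f g).src) ∧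
      (∀ t, e t ≫ p₂ = (t.down.span f g).tgt) ∧
      Sieve.ofArrows _ e ∈ Sheaf.canonicalTopology C R := by
  have := h.hasFiniteLimits
  obtain ⟨R, i, e, hi, he, hcov⟩ := h.exists_image
    (fun t : ULift.{w} ZigzagShape => prod.lift (t.down.span f g).src (t.down.span f g).tgt)
  have he₁ (t) : e t ≫ i ≫ prod.fst = (t.down.span f g).src := by
    rw [reassoc_of% (he t), prod.lift_fst]
  have he₂ (t) : e t ≫ i ≫ prod.snd = (t.down.span f g).tgt := by
    rw [reassoc_of% (he t), prod.lift_snd]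
  have hmono : JointlyMono₂ (i ≫ prod.fst) (i ≫ prod.snd) := ⟨fun Y a b h₁ h₂ => by
    rw [← cancel_mono i]
    ext
    · simpa using h₁
    · simpa using h₂⟩
  -- Since `R` is mono in the product, symmetry may be checked on the cover by zigzags, where
  -- reversing a zigzag only changes its shape.
  obtain ⟨s, hs⟩ : ∃ s : R ⟶ R, s ≫ i = prod.lift (i ≫ prod.snd) (i ≫ prod.fst) := by
    refine exists_factor_of_mem_canonicalTopology i _ hcov ?_
    rintro A _ ⟨_, a, _, ⟨t⟩, rfl⟩
    let e' : (t.down.span f g).pt ⟶ R := e ⟨t.down.symm⟩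
    have he' : e' ≫ i = prod.lift (t.down.span f g).tgt (t.down.span f g).src := he ⟨t.down.symm⟩
    refine ⟨a ≫ e', ?_⟩
    rw [Category.assoc, he', Category.assoc]
    ext
    · simp only [Category.assoc, prod.lift_fst, he₂]
    · simp only [Category.assoc, prod.lift_snd, he₁]
  let c := pullback.cone (i ≫ prod.snd) (i ≫ prod.fst)
  obtain ⟨k, hk⟩ : ∃ k : pullback (i ≫ prod.snd) (i ≫ prod.fst) ⟶ R,
      k ≫ i = prod.lift (pullback.fst _ _ ≫ i ≫ prod.fst) (pullback.snd _ _ ≫ i ≫ prod.snd) := by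
    -- On the common refinement of the two pulled back covers, both composable pairs come from
    -- zigzags of shapes `t` and `t'`, and these concatenate to one of shape `t.trans t'`.
    refine exists_factor_of_mem_canonicalTopology i _
      (GrothendieckTopology.intersection_covering _
        (GrothendieckTopology.pullback_stable _ (pullback.fst _ _) hcov)
        (GrothendieckTopology.pullback_stable _ (pullback.snd _ _) hcov)) ?_
    rintro A z ⟨⟨_, a, _, ⟨t⟩, ha⟩, ⟨_, b, _, ⟨t'⟩, hb⟩⟩
    have hab : a ≫ (t.down.span f g).tgt = b ≫ (t'.down.span f g).src := by
      rw [← he₁, ← he₂, reassoc_of% ha, reassoc_of% hb, pullback.condition]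
    let e' : pullback (t.down.span f g).tgt (t'.down.span f g).src ⟶ R :=
      e ⟨t.down.trans t'.down⟩
    have he' : e' ≫ i = prod.lift (pullback.fst _ _ ≫ (t.down.span f g).src)
      (pullback.snd _ _ ≫ (t'.down.span f g).tgt) := he ⟨t.down.trans t'.down⟩
    refine ⟨pullback.lift a b hab ≫ e', ?_⟩
    rw [Category.assoc, he']
    ext
    · simp only [Category.assoc, prod.lift_fst]
      rw [← reassoc_of% ha, he₁, pullback.lift_fst_assoc]
    · simp only [Category.assoc, prod.lift_snd]
      rw [← reassoc_of% hb, he₂, pullback.lift_snd_assoc]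
  refine ⟨R, i ≫ prod.fst, i ≫ prod.snd, e, ⟨⟨?_⟩⟩, he₁, he₂, hcov⟩
  exact
    { toJointlyMono₂ := hmono
      r := e ⟨.refl⟩
      reflexivity₁ := he₁ ⟨.refl⟩
      reflexivity₂ := he₂ ⟨.refl⟩
      s := s
      symmetry₁ := by rw [reassoc_of% hs, prod.lift_fst]
      symmetry₂ := by rw [reassoc_of% hs, prod.lift_snd]
      c := c
      isLimit := pullback.isLimit _ _
      t := k
      transitivity₁ := by rw [reassoc_of% hk, prod.lift_fst]; rfl
      transitivity₂ := by rw [reassoc_of% hk, prod.lift_snd]; rfl }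

/-- A sheaf for the canonical topology turns coequalizers into equalizers. -/
theorem existsUnique_of_isSheaf {P : Cᵒᵖ ⥤ Type u'}
    (hP : Presieve.IsSheaf (Sheaf.canonicalTopology C) P) {X U : C} {f g : X ⟶ U}
    {c : Cofork f g} (hc : IsColimit c) (x : P.obj (op U)) (hx : P.map f.op x = P.map g.op x) :
    ∃! y : P.obj (op c.pt), P.map c.π.op y = x := by
  have := h.hasPullbacks
  obtain ⟨R, p₁, p₂, e, hR, he₁, he₂, hcov⟩ := h.exists_generatedRelation f g
  obtain ⟨⟨E⟩⟩ := h.effective R U p₁ p₂ hR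
  -- The pair `f, g` is the zigzag of shape `rel`, so it factors through `R`.
  have hE : f ≫ E.π = g ≫ E.π := by
    have h₁ := he₁ ⟨.rel⟩
    have h₂ := he₂ ⟨.rel⟩
    change f ≫ E.π = g ≫ E.π
    exact (congrArg (· ≫ E.π) h₁).symm.trans (((Category.assoc _ _ _).trans
      ((congrArg (e ⟨.rel⟩ ≫ ·) E.isKernelPair.w).trans (Category.assoc _ _ _).symm)).trans
        (congrArg (· ≫ E.π) h₂))
  -- Equality of sections over `R` is local, and along each zigzag `x` restricts equally to both
  -- ends.
  have hp : P.map p₁.op x = P.map p₂.op x := by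
    refine (hP _ hcov).isSeparatedFor.ext ?_
    rintro A _ ⟨_, a, _, ⟨t⟩, rfl⟩
    have h₁ : P.map (e t).op (P.map p₁.op x) = P.map (t.down.span f g).src.op x := by
      rw [← he₁, op_comp, P.map_comp]
      rfl
    have h₂ : P.map (e t).op (P.map p₂.op x) = P.map (t.down.span f g).tgt.op x := by
      rw [← he₂, op_comp, P.map_comp]
      rfl
    rw [op_comp, P.map_comp]
    exact congrArg (P.map a.op) (h₁.trans ((ZigzagShape.map_src_eq_map_tgt hx _).trans h₂.symm))
  let π : U ⟶ c.pt := c.π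
  have hs : Presieve.IsSheafFor P (Sieve.generate (Presieve.singleton π)).arrows :=
    hP _ (h.generate_singleton_mem hc)
  rw [← Presieve.isSheafFor_iff_generate, ← Presieve.ofArrows_pUnit.{0},
    Presieve.isSheafFor_arrows_iff] at hs
  obtain ⟨y, hy, hy'⟩ := hs (fun _ => x) (by
    rintro ⟨⟩ ⟨⟩ Z a b hab
    -- As `E.π` factors through `π`, a pair identified by `π` is identified by `E.π`, hence factors
    -- through `R` because `R` is the kernel pair of `E.π`.
    obtain ⟨d, hd⟩ := Cofork.IsColimit.desc' hc E.π hE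
    have hab : a ≫ π = b ≫ π := hab
    have hd : π ≫ d = E.π := hd
    have hab' : a ≫ E.π = b ≫ E.π := by rw [← hd, reassoc_of% hab]
    obtain ⟨k, rfl, rfl⟩ : ∃ k : Z ⟶ R, k ≫ p₁ = a ∧ k ≫ p₂ = b :=
      ⟨_, E.isKernelPair.lift_fst a b hab', E.isKernelPair.lift_snd a b hab'⟩
    rw [op_comp, op_comp, P.map_comp, P.map_comp]
    exact congrArg (P.map _) hp)
  exact ⟨y, hy ⟨⟩, fun z hz => hy' z (fun _ => hz)⟩

/-- A sheaf for the canonical topology turns small coproducts into products. -/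
theorem existsUnique_of_isSheaf_coproduct {P : Cᵒᵖ ⥤ Type u'}
    (hP : Presieve.IsSheaf (Sheaf.canonicalTopology C) P) {ι : Type w} {X : ι → C}
    {c : Cofan X} (hc : IsColimit c) (x : ∀ i, P.obj (op (X i))) :
    ∃! y : P.obj (op c.pt), ∀ i, P.map (c.inj i).op y = x i := by
  have := h.hasPullbacks
  have := h.disjoint ι
  have := h.hasColimits
  have hs := hP _ (h.ofArrows_inj_mem hc)
  rw [← Presieve.isSheafFor_iff_generate, Presieve.isSheafFor_arrows_iff] at hs
  refine hs x ?_
  intro i j Z a b hab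
  by_cases hij : i = j
  · subst hij
    have := Mono.of_coproductDisjoint hc i
    rw [(cancel_mono (c.inj i)).1 hab]
  -- An overlap of distinct summands maps to an initial object, so the empty sieve covers it and any
  -- two sections agree.
  · let k : Z ⟶ pullback (c.inj i) (c.inj j) := pullback.lift a b hab
    have hI : IsInitial (pullback (c.inj i) (c.inj j)) :=
      IsInitial.ofCoproductDisjointOfIsColimitOfIsLimit hij hc (pullback.isLimit _ _)
    have hZ : ⊥ ∈ Sheaf.canonicalTopology C Z :=
      GrothendieckTopology.superset_covering _ (by rintro A a ha; exact ha)
        (GrothendieckTopology.pullback_stable _ k (h.bot_mem hI))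
    exact (hP _ hZ).isSeparatedFor.ext (fun A a ha => ha.elim)

end IsInftyPretopos

/-! ### Cocontinuity of the Yoneda embedding into canonical sheaves -/

namespace IsInftyPretopos

variable {C : Type u} [Category.{v} C] (h : IsInftyPretopos.{w} C)
include h

theorem preservesCoequalizers_uliftYoneda :
    PreservesColimitsOfShape WalkingParallelPair
      (Sheaf.canonicalTopology C).uliftYoneda.{u'} where
  preservesColimit {K} := by
    have := h.hasCoequalizers
    let J := Sheaf.canonicalTopology C
    let Y := J.uliftYoneda.{u'}
    suffices ∀ {A B : C} (f g : A ⟶ B), PreservesColimit (parallelPair f g) Y from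
      preservesColimit_of_iso_diagram Y (diagramIsoParallelPair K).symm
    intro A B f g
    refine preservesColimit_of_preserves_colimit_cocone (coequalizerIsCoequalizer f g) ?_
    refine (isColimitMapCoconeCoforkEquiv Y _).symm ?_
    have key (s : Cofork (Y.map f) (Y.map g)) :
        ∃! y : s.pt.obj.obj (op (coequalizer f g)),
          s.pt.obj.map (coequalizer.π f g).op y = J.uliftYonedaEquiv s.π := by
      refine h.existsUnique_of_isSheaf ((isSheaf_iff_isSheaf_of_type _ _).1 s.pt.property)
        (coequalizerIsCoequalizer f g) _ ?_
      exact (J.uliftYonedaEquiv_naturality s.π f).trans ((congrArg _ s.condition).trans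
        (J.uliftYonedaEquiv_naturality s.π g).symm)
    refine Cofork.IsColimit.mk _ (fun s => J.uliftYonedaEquiv.symm (key s).choose) ?_ ?_
    · intro s
      apply J.uliftYonedaEquiv.injective
      refine (J.uliftYonedaEquiv_naturality _ _).symm.trans ?_
      rw [Equiv.apply_symm_apply]
      exact (key s).choose_spec.1
    · intro s m hm
      apply J.uliftYonedaEquiv.injective
      rw [Equiv.apply_symm_apply]
      refine (key s).choose_spec.2 _ ?_
      exact (J.uliftYonedaEquiv_naturality _ _).trans (congrArg _ hm)

theorem preservesCoproducts_uliftYoneda (ι : Type w) :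
    PreservesColimitsOfShape (Discrete ι) (Sheaf.canonicalTopology C).uliftYoneda.{u'} := by
  let J := Sheaf.canonicalTopology C
  let Y := J.uliftYoneda.{u'}
  suffices ∀ X : ι → C, PreservesColimit (Discrete.functor X) Y from
    preservesColimitsOfShape_of_discrete Y
  refine fun X => ⟨fun {c : Cofan X} hc => ⟨(Cofan.isColimitMapCoconeEquiv _ _ _).symm ?_⟩⟩
  have key (s : Cofan fun i => Y.obj (X i)) :
      ∃! y : s.pt.obj.obj (op c.pt),
        ∀ i, s.pt.obj.map (c.inj i).op y = J.uliftYonedaEquiv (s.inj i) :=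
    h.existsUnique_of_isSheaf_coproduct ((isSheaf_iff_isSheaf_of_type _ _).1 s.pt.property) hc _
  refine Cofan.IsColimit.mk _ (fun s => J.uliftYonedaEquiv.symm (key s).choose) ?_ ?_
  · intro s i
    apply J.uliftYonedaEquiv.injective
    refine (J.uliftYonedaEquiv_naturality _ _).symm.trans ?_
    rw [Equiv.apply_symm_apply]
    exact (key s).choose_spec.1 i
  · intro s m hm
    apply J.uliftYonedaEquiv.injective
    rw [Equiv.apply_symm_apply]
    refine (key s).choose_spec.2 _ fun i => ?_
    exact (J.uliftYonedaEquiv_naturality _ _).trans (congrArg _ (hm i))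

/-- The Yoneda embedding into sheaves for the canonical topology is cocontinuous. -/
theorem preservesColimits_uliftYoneda :
    PreservesColimitsOfSize.{w, w} (Sheaf.canonicalTopology C).uliftYoneda.{u'} :=
  have := h.hasColimits
  have := h.hasCoequalizers
  have := h.preservesCoequalizers_uliftYoneda
  have := h.preservesCoproducts_uliftYoneda
  preservesColimits_of_preservesCoequalizers_and_coproducts _

end IsInftyPretopos

/-! ### Limits of small presheaves and the reflector -/

namespace LexCocompletion

section

variable {C : Type u} [Category.{v} C] [LocallySmall.{w} C]

/-- Limits of small presheaves are computed pointwise. -/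
instance : PreservesLimitsOfSize.{v', u'} (IsSmallPresheaf.{w} (C := C)).ι where
  preservesLimitsOfShape {J _} := ⟨fun {K} => ⟨fun {c} hc => ⟨by
    refine evaluationJointlyReflectsLimits _ (fun X => Nonempty.some ?_)
    rw [Types.isLimit_iff]
    intro s hs
    -- By the Yoneda lemma, a compatible family of elements at `X` is a cone with vertex the
    -- representable at `X`.
    let q : Cone K :=
      { pt := (yo C).obj X.unop
        π :=
          { app j := yoEquiv.symm (s j)
            naturality i j f := by
              refine (Category.id_comp _).trans ?_
              apply yoEquiv.injective
              refine (Equiv.apply_symm_apply _ _).trans ?_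
              rw [yoEquiv_comp, Equiv.apply_symm_apply]
              exact (hs f).symm } }
    refine ⟨yoEquiv (hc.lift q), fun j => ?_, fun y hy => ?_⟩
    · refine (yoEquiv_comp (hc.lift q) (c.π.app j)).symm.trans ?_
      rw [hc.fac]
      exact Equiv.apply_symm_apply _ _
    · apply yoEquiv.symm.injective
      rw [Equiv.symm_apply_apply]
      refine hc.uniq q _ fun j => ?_
      apply yoEquiv.injective
      rw [yoEquiv_comp, Equiv.apply_symm_apply]
      exact (hy j).trans (Equiv.apply_symm_apply _ _).symm⟩⟩⟩

/-- The left adjoint of the Yoneda embedding of a cocomplete category. -/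
noncomputable def reflector [HasColimitsOfSize.{w, w} C] : SmallPresheaf.{w} C ⥤ C :=
  (yo.{w} C).lan.obj (𝟭 C)

/-- The left adjoint of the Yoneda embedding restricts to the identity. -/
noncomputable def yoCompReflector [HasColimitsOfSize.{w, w} C] :
    yo.{w} C ⋙ reflector ≅ 𝟭 C :=
  (asIso ((yo.{w} C).lanUnit.app (𝟭 C))).symm

theorem lanHomEquiv_naturality_right {E : (yo.{w} C).LeftExtension (𝟭 C)}
    (hE : E.IsPointwiseLeftKanExtension) (φ : SmallPresheaf.{w} C) {d d' : C}
    (k : E.right.obj φ ⟶ d) (g : d ⟶ d') :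
    lanHomEquiv hE φ d' (k ≫ g) = lanHomEquiv hE φ d k ≫ shrinkYoneda.{w}.map g := by
  ext c x
  apply shrinkYonedaObjObjEquiv.injective
  refine (Equiv.apply_symm_apply _ _).trans ?_
  refine Eq.trans ?_ (shrinkYonedaObjObjEquiv_map_app _ _).symm
  refine Eq.trans ?_ (congrArg (· ≫ g) (Equiv.apply_symm_apply _ _).symm)
  simp

/-- The left Kan extension of the identity along the Yoneda embedding is left adjoint to it. -/
noncomputable def reflectorAdjunction [HasColimitsOfSize.{w, w} C] :
    reflector.{w} ⊣ yo.{w} C :=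
  let hE := isPointwiseLeftKanExtensionOfIsLeftKanExtension _ ((yo.{w} C).lanUnit.app (𝟭 C))
  Adjunction.mkOfHomEquiv
    { homEquiv := fun φ d => (lanHomEquiv hE φ d).trans
        { toFun := fun t => ObjectProperty.homMk t
          invFun := fun t => t.hom
          left_inv := fun _ => rfl
          right_inv := fun _ => rfl }
      homEquiv_naturality_left_symm := fun {φ ψ d} f t => by
        refine (Equiv.symm_apply_eq _).2 ?_
        apply ObjectProperty.hom_ext
        refine Eq.trans ?_ (lanHomEquiv_naturality hE d f _).symm
        exact congrArg (f.hom ≫ ·) (Equiv.apply_symm_apply (lanHomEquiv hE ψ d) t.hom).symm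
      homEquiv_naturality_right := fun {φ d d'} k g => by
        apply ObjectProperty.hom_ext
        exact lanHomEquiv_naturality_right hE φ k g }

end

end LexCocompletion

/-! ### The reflector of an ∞-pretopos is left exact -/

namespace IsInftyPretopos

open LexCocompletion

variable {C : Type u} [Category.{w} C] (h : IsInftyPretopos.{w} C)
include h

/-- The reflector followed by the embedding `Y` into sheaves is sheafification of small presheaves,
both being cocontinuous with the same restriction to representables; `Y` reflects finite limits.
Values are lifted to `Type (max w u)` because `C` may be large and sheafification needs the room. -/
theorem hasLexReflector [HasFiniteLimits C] : HasLexReflector.{w} C := by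
  have := h.hasColimits
  refine ⟨reflector, ⟨reflectorAdjunction⟩, ?_⟩
  let J := Sheaf.canonicalTopology C
  let Y := J.uliftYoneda.{u}
  have : PreservesColimitsOfSize.{w, w} Y := h.preservesColimits_uliftYoneda
  have := (reflectorAdjunction.{w} (C := C)).leftAdjoint_preservesColimits
  let G : SmallPresheaf.{w} C ⥤ Sheaf J (Type (max w u)) :=
    (IsSmallPresheaf.{w}).ι ⋙ (whiskeringRight _ _ _).obj uliftFunctor.{u} ⋙ presheafToSheaf J _
  have hG : PreservesColimitsOfSize.{w, w} G := inferInstance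
  have hG' : PreservesFiniteLimits G := by
    have : PreservesFiniteLimits (IsSmallPresheaf.{w} (C := C)).ι := ⟨fun _ _ _ => inferInstance⟩
    have : PreservesFiniteLimits ((whiskeringRight Cᵒᵖ (Type w) _).obj uliftFunctor.{u}) := ⟨fun _ _ _ => inferInstance⟩
    infer_instance
  let e₁ : yo.{w} C ⋙ G ≅ Y ⋙ sheafToPresheaf J _ ⋙ presheafToSheaf J _ :=
    isoWhiskerRight (isoWhiskerRight shrinkYonedaIsoYoneda
      ((whiskeringRight Cᵒᵖ (Type w) _).obj uliftFunctor.{u})) (presheafToSheaf J _)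
  let e₂ : Y ⋙ sheafToPresheaf J _ ⋙ presheafToSheaf J _ ≅ Y :=
    isoWhiskerLeft Y (sheafificationNatIso J _).symm ≪≫ Y.rightUnitor
  let e₃ : yo.{w} C ⋙ reflector.{w} ⋙ Y ≅ Y := isoWhiskerRight yoCompReflector Y ≪≫ Y.leftUnitor
  let e : yo.{w} C ⋙ G ≅ yo.{w} C ⋙ reflector.{w} ⋙ Y := e₁ ≪≫ e₂ ≪≫ e₃.symm
  let e' : G ≅ reflector.{w} ⋙ Y := extIso e
  have : PreservesFiniteLimits (reflector.{w} ⋙ Y) := preservesFiniteLimits_of_natIso e'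
  exact preservesFiniteLimits_of_reflects_of_preserves reflector Y

end IsInftyPretopos

/-! ### Exactness properties of sets and presheaves -/

namespace CategoryTheory

/-- Colimits of types are stable under pullback. -/
theorem Limits.Types.isUniversalColimit {J : Type u'} [Category.{v'} J] {F : J ⥤ Type w}
    {c : Cocone F} (hc : IsColimit c) : IsUniversalColimit c := by
  intro F' c' α f h hα H
  have hw (j : J) (x : F'.obj j) : c.ι.app j (α.app j x) = f (c'.ι.app j x) :=
    congrArg (fun t => t x) (NatTrans.congr_app h j)
  have hw' {i j : J} (m : i ⟶ j) (x : F'.obj i) : c'.ι.app j (F'.map m x) = c'.ι.app i x :=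
    congrArg (fun t => t x) (c'.w m)
  -- the relation between elements of `c.pt`, elements of `c'.pt` over it, and their values
  let q (s : Cocone F') : Cocone F :=
    { pt := c'.pt → Set s.pt
      ι :=
        { app j := ↾fun y p => {z | ∃ x, α.app j x = y ∧ c'.ι.app j x = p ∧ s.ι.app j x = z}
          naturality i j m := by
            ext y
            funext p
            ext z
            constructor
            · rintro ⟨x, hx, hp, hz⟩
              -- Equifibredness of `α` lifts the witness at `j` to one at `i`.
              obtain ⟨x', hx', hx''⟩ := Types.exists_of_isPullback (hα m) x y hx
              refine ⟨x', hx'', ?_, ?_⟩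
              · rw [← hp, ← hx', hw']
              · rw [← hz, ← hx']
                exact (congrArg (fun t => t x') (s.w m)).symm
            · rintro ⟨x, hx, hp, hz⟩
              refine ⟨F'.map m x, ?_, ?_, ?_⟩
              · rw [← hx]
                exact α.naturality_apply m x
              · rw [hw', hp]
              · rw [← hz]
                exact congrArg (fun t => t x) (s.w m) } }
  -- By the pullback square `H j`, a point of `F'.obj j` is determined by its images in `F.obj j`
  -- and `c'.pt`, so the set of values is a singleton and defines a function.
  have hq (s : Cocone F') (j : J) (x : F'.obj j) (z : s.pt) :
      z ∈ (show c'.pt → Set s.pt from hc.desc (q s) (f (c'.ι.app j x))) (c'.ι.app j x) ↔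
        z = s.ι.app j x := by
    have e : hc.desc (q s) (c.ι.app j (α.app j x)) = (q s).ι.app j (α.app j x) :=
      congrArg (fun t => t (α.app j x)) (hc.fac (q s) j)
    rw [← hw, e]
    constructor
    · rintro ⟨x', h₁, h₂, rfl⟩
      rw [Types.ext_of_isPullback (H j) h₂ h₁]
    · rintro rfl
      exact ⟨x, rfl, rfl, rfl⟩
  have hsurj (p : c'.pt) : ∃ (j : J) (x : F'.obj j), c'.ι.app j x = p := by
    obtain ⟨j, y, hy⟩ := Types.jointly_surjective_of_isColimit hc (f p)
    obtain ⟨x, hx, -⟩ := Types.exists_of_isPullback (H j) p y hy.symm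
    exact ⟨j, x, hx⟩
  have hex (s : Cocone F') (p : c'.pt) :
      ∃ z, z ∈ (show c'.pt → Set s.pt from hc.desc (q s) (f p)) p := by
    obtain ⟨j, x, rfl⟩ := hsurj p
    exact ⟨_, (hq s j x _).2 rfl⟩
  refine ⟨{ desc := fun s => ↾fun p => (hex s p).choose, fac := fun s j => ?_,
            uniq := fun s m hm => ?_ }⟩
  · ext x
    exact (hq s j x _).1 (hex s (c'.ι.app j x)).choose_spec
  · ext p
    obtain ⟨j, x, rfl⟩ := hsurj p
    exact (congrArg (fun t => t x) (hm j)).trans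
      ((hq s j x _).1 (hex s (c'.ι.app j x)).choose_spec).symm

/-- Colimits of presheaves are stable under pullback. -/
theorem Limits.FunctorToTypes.isUniversalColimit {D : Type u} [Category.{v} D] {J : Type w}
    [SmallCategory J] {F : J ⥤ D ⥤ Type w} {c : Cocone F} (hc : IsColimit c) :
    IsUniversalColimit c := by
  intro F' c' α f h hα H
  refine ⟨evaluationJointlyReflectsColimits _ fun x => ?_⟩
  refine (Types.isUniversalColimit (isColimitOfPreserves ((evaluation D (Type w)).obj x) hc)
    (((evaluation D (Type w)).obj x).mapCocone c') (whiskerRight α _)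
    (((evaluation D (Type w)).obj x).map f) ?_ (hα.whiskerRight _)
    fun j => (H j).map ((evaluation D (Type w)).obj x)).some
  exact NatTrans.ext (funext fun j => NatTrans.congr_app (NatTrans.congr_app h j) x)

/-- Equivalence relations on types are effective. -/
theorem Limits.Types.isPullback_of_isColimit_cofork {R X : Type w} {p₁ p₂ : R ⟶ X}
    {c : Cofork p₁ p₂} (hc : IsColimit c) (hm : ∀ a b, p₁ a = p₁ b → p₂ a = p₂ b → a = b)
    (he : _root_.Equivalence (TypeCat.Rel.ofPair p₁ p₂)) : IsPullback p₁ p₂ c.π c.π := by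
  rw [Types.isPullback_iff]
  refine ⟨c.condition, fun a b h => hm a b h.1 h.2, fun a b h => ?_⟩
  -- The map to equivalence classes factors through the quotient, so points with equal image there
  -- are related.
  let q : X ⟶ Set X := ↾fun x => {y | TypeCat.Rel.ofPair p₁ p₂ x y}
  have hq : p₁ ≫ q = p₂ ≫ q := by
    refine ConcreteCategory.hom_ext _ _ fun r => ?_
    have hr : TypeCat.Rel.ofPair p₁ p₂ (p₁ r) (p₂ r) := ⟨r, rfl, rfl⟩
    exact Set.ext fun y => ⟨he.trans (he.symm hr), he.trans hr⟩
  have hd (x : X) : Cofork.IsColimit.desc hc q hq (c.π x) = q x :=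
    congrArg (fun t => t x) (Cofork.IsColimit.π_desc' hc q hq)
  have : q a = q b := by rw [← hd, h, hd]
  have hb : b ∈ (show Set X from q b) := he.refl b
  rw [← this] at hb
  exact hb

/-- The coequalizer of a reflexive pair is its pushout. -/
theorem IsPushout.of_isColimit_cofork {D : Type u} [Category.{v} D] {R X : D} {p₁ p₂ : R ⟶ X}
    {c : Cofork p₁ p₂} (hc : IsColimit c) {r : X ⟶ R} (h₁ : r ≫ p₁ = 𝟙 X) (h₂ : r ≫ p₂ = 𝟙 X) :
    IsPushout p₁ p₂ c.π c.π := by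
  have h (s : PushoutCocone p₁ p₂) : s.inl = s.inr := by
    rw [← Category.id_comp s.inl, ← h₁, Category.assoc, s.condition, reassoc_of% h₂]
  refine ⟨⟨c.condition⟩, ⟨PushoutCocone.IsColimit.mk _
    (fun s => Cofork.IsColimit.desc hc s.inl (by rw [s.condition, h])) (fun s => ?_) (fun s => ?_)
    (fun s m hm _ => Cofork.IsColimit.hom_ext hc ?_)⟩⟩
  · exact Cofork.IsColimit.π_desc' hc _ _
  · exact (Cofork.IsColimit.π_desc' hc _ _).trans (h s)
  · exact hm.trans (Cofork.IsColimit.π_desc' hc _ _).symm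

theorem IsPullback.of_evaluation {D : Type u} [Category.{v} D] {P X Y Z : D ⥤ Type w}
    {fst : P ⟶ X} {snd : P ⟶ Y} {f : X ⟶ Z} {g : Y ⟶ Z} (w : fst ≫ f = snd ≫ g)
    (h : ∀ x, IsPullback (fst.app x) (snd.app x) (f.app x) (g.app x)) :
    IsPullback fst snd f g :=
  ⟨⟨w⟩, ⟨evaluationJointlyReflectsLimits _ fun x =>
    (isLimitMapConePullbackConeEquiv _ _).symm (h x).isLimit⟩⟩

end CategoryTheory

/-! ### Exactness properties of small presheaves -/

namespace LexCocompletion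

section

variable {C : Type u} [Category.{v} C] [LocallySmall.{w} C]

theorem isUniversalColimit {J : Type w} [SmallCategory J] {F : J ⥤ SmallPresheaf.{w} C}
    {c : Cocone F} (hc : IsColimit c) : IsUniversalColimit c :=
  IsUniversalColimit.of_mapCocone (IsSmallPresheaf.{w} (C := C)).ι
    (FunctorToTypes.isUniversalColimit (isColimitOfPreserves _ hc))

/-- Small presheaves are small colimits of representables. -/
theorem exists_isColimit_yo (φ : SmallPresheaf.{w} C) :
    ∃ (J : Type w) (_ : SmallCategory J) (F : J ⥤ C) (c : Cocone (F ⋙ yo.{w} C)) (_ : c.pt ≅ φ),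
      Nonempty (IsColimit c) :=
  ⟨FinalModel.{w} (CostructuredArrow (yo.{w} C) φ), inferInstance,
    fromFinalModel.{w} (CostructuredArrow (yo.{w} C) φ) ⋙ CostructuredArrow.proj _ _,
    Cocone.whisker (fromFinalModel.{w} (CostructuredArrow (yo.{w} C) φ))
      ((LeftExtension.mk (𝟭 _) (yo.{w} C).rightUnitor.inv).coconeAt φ), Iso.refl _,
    ⟨(Final.isColimitWhiskerEquiv _ _).symm ((yo.{w} C).denseAt φ)⟩⟩

/-- The Yoneda embedding into small presheaves preserves limits. -/
instance : PreservesLimitsOfSize.{v', u'} (yo.{w} C) where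
  preservesLimitsOfShape {J _} := ⟨fun {K} => ⟨fun {c} hc => ⟨by
    refine isLimitOfReflects (IsSmallPresheaf.{w} (C := C)).ι ?_
    refine evaluationJointlyReflectsLimits _ (fun X => Nonempty.some ?_)
    rw [Types.isLimit_iff]
    intro s hs
    let q : Cone K :=
      { pt := X.unop
        π :=
          { app j := shrinkYonedaObjObjEquiv (s j)
            naturality i j f := by
              refine (Category.id_comp _).trans ?_
              rw [← hs f]
              exact shrinkYonedaObjObjEquiv_map_app _ _ } }
    have e (y : X.unop ⟶ c.pt) (j : J) :
        shrinkYonedaObjObjEquiv ((shrinkYoneda.{w}.map (c.π.app j)).app X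
          (shrinkYonedaObjObjEquiv.symm y)) = y ≫ c.π.app j :=
      (shrinkYonedaObjObjEquiv_map_app _ _).trans (by simp)
    refine ⟨shrinkYonedaObjObjEquiv.symm (hc.lift q), fun j => ?_, fun y hy => ?_⟩
    · apply shrinkYonedaObjObjEquiv.injective
      exact (e _ j).trans (hc.fac q j)
    · obtain ⟨y, rfl⟩ := shrinkYonedaObjObjEquiv.symm.surjective y
      refine congrArg _ (hc.uniq q _ fun j => ?_)
      exact (e _ j).symm.trans (congrArg shrinkYonedaObjObjEquiv (hy j))⟩⟩⟩

/-- The pullback of all presheaves is small: write `φ` as a small colimit of representables; by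
stability the pullback is the colimit of the pulled back diagram, which consists of representables
as `C` has pullbacks. These pullbacks are what the transfer of universal colimits along the
reflector requires. -/
theorem hasPullback_yo [HasPullbacks C] {X d : C} (f : X ⟶ d) {φ : SmallPresheaf.{w} C}
    (a : φ ⟶ (yo.{w} C).obj d) : HasPullback ((yo.{w} C).map f) a := by
  obtain ⟨J, _, F, c, e, ⟨hc⟩⟩ := exists_isColimit_yo φ
  let ι := (IsSmallPresheaf.{w} (C := C)).ι
  let cd : Cocone F :=
    { pt := d
      ι := { app j := fullyFaithfulYo.preimage (c.ι.app j ≫ e.hom ≫ a)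
             naturality i j m := by
              apply (yo.{w} C).map_injective
              have := c.w m
              dsimp at this
              simp [reassoc_of% this] } }
  let P := pullback (ι.map ((yo.{w} C).map f)) (ι.map (e.hom ≫ a))
  have hcd (j : J) : (yo.{w} C).map (cd.leg j) = c.ι.app j ≫ e.hom ≫ a :=
    fullyFaithfulYo.map_preimage _
  have sq (j : J) : IsPullback (ι.map ((yo.{w} C).map (pullback.fst f (cd.leg j))))
      (ι.map ((yo.{w} C).map (pullback.snd f (cd.leg j)))) (ι.map ((yo.{w} C).map f))
      (ι.map (c.ι.app j) ≫ ι.map (e.hom ≫ a)) := by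
    have := ((IsPullback.of_hasPullback f (cd.leg j)).map (yo.{w} C)).map ι
    rwa [hcd, ι.map_comp] at this
  have sqP : IsPullback (pullback.fst (ι.map ((yo.{w} C).map f)) (ι.map (e.hom ≫ a)))
      (pullback.snd (ι.map ((yo.{w} C).map f)) (ι.map (e.hom ≫ a))) _ _ := .of_hasPullback _ _
  let l (j : J) : ι.obj ((yo.{w} C).obj (pullback f (cd.leg j))) ⟶ P :=
    sqP.lift (ι.map ((yo.{w} C).map (pullback.fst f (cd.leg j))))
      (ι.map ((yo.{w} C).map (pullback.snd f (cd.leg j))) ≫ ι.map (c.ι.app j))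
      (by rw [Category.assoc]; exact (sq j).w)
  have sql (j : J) : IsPullback (l j) (ι.map ((yo.{w} C).map (pullback.snd f (cd.leg j))))
      (pullback.snd _ _) (ι.map (c.ι.app j)) :=
    .of_right (by rw [IsPullback.lift_fst]; exact (sq j)) (sqP.lift_snd _ _ _) sqP
  let α : cd.pullbackDiagram f ⋙ yo.{w} C ⋙ ι ⟶ (F ⋙ yo.{w} C) ⋙ ι :=
    { app j := ι.map ((yo.{w} C).map (pullback.snd f (cd.leg j)))
      naturality i j m := by
        have := cd.pullbackDiagram_map_snd f m
        exact ((((yo.{w} C) ⋙ ι).map_comp _ _).symm.trans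
          (congrArg ((yo.{w} C) ⋙ ι).map this)).trans (((yo.{w} C) ⋙ ι).map_comp _ _) }
  let c' : Cocone (cd.pullbackDiagram f ⋙ yo.{w} C ⋙ ι) :=
    { pt := P
      ι :=
        { app j := l j
          naturality i j m := by
            refine Eq.trans ?_ (Category.comp_id _).symm
            apply sqP.hom_ext
            · rw [Category.assoc, sqP.lift_fst, sqP.lift_fst]
              exact ((ι.map_comp _ _).symm.trans (congrArg ι.map ((yo.{w} C).map_comp _ _).symm)).trans
                (congrArg (fun t => ι.map ((yo.{w} C).map t)) (cd.pullbackDiagram_map_fst f m))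
            · rw [Category.assoc, (sql j).w, (sql i).w]
              refine (reassoc_of% (α.naturality m)) _ |>.trans ?_
              exact congrArg (_ ≫ ·) ((ι.mapCocone c).w m) } }
  obtain ⟨hc'⟩ := FunctorToTypes.isUniversalColimit (isColimitOfPreserves ι hc) c' α
    (pullback.snd _ _) (NatTrans.ext (funext fun j => (sql j).w.symm)) (by
      intro i j m
      have : IsPullback ((cd.pullbackDiagram f).map m) (pullback.snd f (cd.leg i))
          (pullback.snd f (cd.leg j)) (F.map m) := by
        refine IsPullback.of_right (h₁₂ := pullback.fst f (cd.leg j)) (v₁₃ := f)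
          (h₂₂ := cd.leg j) ?_ (cd.pullbackDiagram_map_snd f m) (.of_hasPullback f (cd.leg j))
        rw [cd.pullbackDiagram_map_fst f m, cd.w_leg]
        exact .of_hasPullback f (cd.leg i)
      exact this.map (yo.{w} C ⋙ ι)) sql
  have hP : IsSmallPresheaf.{w} P :=
    ObjectProperty.prop_of_isColimit _ hc' fun j => ((yo.{w} C).obj _).property
  let P' : SmallPresheaf.{w} C := ⟨P, hP⟩
  have : IsPullback (ObjectProperty.homMk (pullback.fst _ _) : P' ⟶ _)
      (ObjectProperty.homMk (pullback.snd _ _) : P' ⟶ _) ((yo.{w} C).map f) (e.hom ≫ a) :=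
    .of_map ι (ObjectProperty.hom_ext _ sqP.w) sqP
  exact (this.of_iso (snd' := ObjectProperty.homMk (pullback.snd _ _) ≫ e.hom) (.refl _) (.refl _) e
    (.refl _) ((Category.comp_id _).trans (Category.id_comp _).symm) (Category.id_comp _).symm
    (by simp) (by simp)).hasPullback

/-- Pointwise, an equivalence relation in `C` is one on hom-sets, and coequalizers of small
presheaves are pointwise, so effectiveness is that of sets. -/
theorem isKernelPair_yo {R X : C} {p₁ p₂ : R ⟶ X} (e : EquivalenceRelation p₁ p₂)
    {c : Cofork ((yo.{w} C).map p₁) ((yo.{w} C).map p₂)} (hc : IsColimit c) :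
    IsPullback ((yo.{w} C).map p₁) ((yo.{w} C).map p₂) c.π c.π := by
  let ι := (IsSmallPresheaf.{w} (C := C)).ι
  refine .of_map ι c.condition (.of_evaluation ((ι.map_comp _ _).symm.trans
    ((congrArg ι.map c.condition).trans (ι.map_comp _ _))) fun x => ?_)
  let G := ι ⋙ (evaluation Cᵒᵖ (Type w)).obj x
  have hp₁ (a : x.unop ⟶ R) : G.map ((yo.{w} C).map p₁) (shrinkYonedaObjObjEquiv.symm a) =
      shrinkYonedaObjObjEquiv.symm (a ≫ p₁) :=
    shrinkYonedaObjObjEquiv.injective ((shrinkYonedaObjObjEquiv_map_app _ _).trans (by simp))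
  have hp₂ (a : x.unop ⟶ R) : G.map ((yo.{w} C).map p₂) (shrinkYonedaObjObjEquiv.symm a) =
      shrinkYonedaObjObjEquiv.symm (a ≫ p₂) :=
    shrinkYonedaObjObjEquiv.injective ((shrinkYonedaObjObjEquiv_map_app _ _).trans (by simp))
  refine Types.isPullback_of_isColimit_cofork (isColimitCoforkMapOfIsColimit G c.condition
    (hc.ofIsoColimit c.isoCoforkOfπ)) ?_ ?_
  · intro a b h₁ h₂
    obtain ⟨a, rfl⟩ := shrinkYonedaObjObjEquiv.symm.surjective a
    obtain ⟨b, rfl⟩ := shrinkYonedaObjObjEquiv.symm.surjective b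
    rw [hp₁, hp₁] at h₁
    rw [hp₂, hp₂] at h₂
    exact congrArg _ (e.right_cancellation a b (shrinkYonedaObjObjEquiv.symm.injective h₁)
      (shrinkYonedaObjObjEquiv.symm.injective h₂))
  · refine ⟨fun a => ?_, ?_, ?_⟩
    · obtain ⟨a, rfl⟩ := shrinkYonedaObjObjEquiv.symm.surjective a
      refine ⟨shrinkYonedaObjObjEquiv.symm (a ≫ e.r), ?_, ?_⟩
      · rw [hp₁]; exact congrArg _ (by simp)
      · rw [hp₂]; exact congrArg _ (by simp)
    · rintro _ _ ⟨r, rfl, rfl⟩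
      obtain ⟨r, rfl⟩ := shrinkYonedaObjObjEquiv.symm.surjective r
      refine ⟨shrinkYonedaObjObjEquiv.symm (r ≫ e.s), ?_, ?_⟩
      · rw [hp₁, hp₂]; exact congrArg _ (by simp [e.symmetry₁])
      · rw [hp₁, hp₂]; exact congrArg _ (by simp [e.symmetry₂])
    · rintro _ _ _ ⟨r, rfl, rfl⟩ ⟨r', h, rfl⟩
      obtain ⟨r, rfl⟩ := shrinkYonedaObjObjEquiv.symm.surjective r
      obtain ⟨r', rfl⟩ := shrinkYonedaObjObjEquiv.symm.surjective r'
      rw [hp₁, hp₂] at h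
      refine ⟨shrinkYonedaObjObjEquiv.symm (PullbackCone.IsLimit.lift e.isLimit r r'
        (shrinkYonedaObjObjEquiv.symm.injective h).symm ≫ e.t), ?_, ?_⟩
      · rw [hp₁, hp₁]; exact congrArg _ (by simp [e.transitivity₁])
      · rw [hp₂, hp₂]; exact congrArg _ (by simp [e.transitivity₂])

section

variable {I : Type w} {X : I → SmallPresheaf.{w} C} {P : SmallPresheaf.{w} C} {f : ∀ i, X i ⟶ P}

theorem mono_inj_of_isColimit (hf : IsColimit (Cofan.mk P f)) (i : I) : Mono (f i) := by
  refine (IsSmallPresheaf.{w}).ι.mono_of_mono_map ?_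
  have (x : Cᵒᵖ) : Mono ((f i).hom.app x) := (mono_iff_injective _).2
    (Cofan.inj_injective_of_isColimit (isColimitCofanMkObjOfIsColimit
      ((IsSmallPresheaf.{w}).ι ⋙ (evaluation Cᵒᵖ (Type w)).obj x) _ _ hf) i)
  exact NatTrans.mono_of_mono_app (f i).hom

theorem isPullback_inj_of_isColimit (hf : IsColimit (Cofan.mk P f)) {i j : I} (hij : i ≠ j) :
    IsPullback (initial.to (X i)) (initial.to (X j)) (f i) (f j) := by
  have h : initial.to (X i) ≫ f i = initial.to (X j) ≫ f j := initial.hom_ext _ _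
  have h' := congrArg InducedCategory.Hom.hom h
  refine .of_map (IsSmallPresheaf.{w}).ι h (.of_evaluation h' fun x => ?_)
  let G := (IsSmallPresheaf.{w}).ι ⋙ (evaluation Cᵒᵖ (Type w)).obj x
  have : IsEmpty (G.obj (⊥_ _)) :=
    (Types.initial_iff_empty _).1 ⟨initialIsInitial.isInitialObj G _⟩
  rw [Types.isPullback_iff]
  refine ⟨NatTrans.congr_app h' x, fun a => isEmptyElim (α := G.obj (⊥_ _)) a, fun a b hab => ?_⟩
  exact (hij (Cofan.eq_of_inj_apply_eq_of_isColimit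
    (isColimitCofanMkObjOfIsColimit G _ _ hf) a b hab)).elim

end

end

/-! ### Transfer of exactness along a lex reflector -/

section

variable {C : Type u} [Category.{w} C] [HasFiniteLimits C]

theorem HasLexReflector.isInftyPretopos (h : HasLexReflector.{w} C) : IsInftyPretopos.{w} C := by
  obtain ⟨L, ⟨adj⟩, hL⟩ := h
  have := adj.leftAdjoint_preservesColimits
  let _ : Reflective (yo.{w} C) := ⟨L, adj⟩
  have hcol : HasColimitsOfSize.{w, w} C := ⟨fun J _ => hasColimitsOfShape_of_reflective (yo.{w} C)⟩
  let u (X : C) : L.obj ((yo.{w} C).obj X) ≅ X := (asIso adj.counit).app X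
  refine ⟨inferInstance, hcol, ?_, ?_, ?_⟩
  · intro J _ F c hc
    have (X) (f : X ⟶ L.obj (colimit.cocone (F ⋙ yo.{w} C)).pt) := hasPullback_yo f (adj.unit.app _)
    have H := IsUniversalColimit.map_reflective adj
      (isUniversalColimit (colimit.isColimit (F ⋙ yo.{w} C)))
    -- The counit is invertible, so the given colimit is the image under `L` of the colimit of `F ⋙
    -- yo`.
    let β : F ≅ (F ⋙ yo.{w} C) ⋙ L := F.rightUnitor.symm ≪≫
      isoWhiskerLeft F (asIso adj.counit).symm ≪≫ (Functor.associator _ _ _).symm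
    refine (H.precompose_isIso β.hom).of_iso (IsColimit.uniqueUpToIso ?_ hc)
    exact (IsColimit.precomposeHomEquiv β _).symm
      (isColimitOfPreserves L (colimit.isColimit (F ⋙ yo.{w} C)))
  · refine fun I => ⟨fun X => ?_⟩
    let d : Cofan fun i => (yo.{w} C).obj (X i) := Cofan.mk _ (Sigma.ι _)
    let hd : IsColimit d := coproductIsCoproduct _
    let c : Cofan X := Cofan.mk (L.obj d.pt) fun i => (u (X i)).inv ≫ L.map (d.inj i)
    let hLd := isColimitCofanMkObjOfIsColimit L _ _ hd
    let hc : IsColimit c := Cofan.IsColimit.mk _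
      (fun s => Cofan.IsColimit.desc hLd fun i => (u (X i)).hom ≫ s.inj i)
      (fun s i => by
        refine (Category.assoc _ _ _).trans ?_
        rw [Iso.inv_comp_eq]
        exact Cofan.IsColimit.fac hLd _ i)
      (fun s m hm => Cofan.IsColimit.hom_ext hLd _ _ fun i => by
        refine Eq.trans ?_ (Cofan.IsColimit.fac hLd _ i).symm
        rw [← Iso.inv_comp_eq, ← hm i]
        exact (Category.assoc _ _ _).symm)
    have (i : I) : Mono (c.inj i) := by
      have : Mono (d.inj i) := mono_inj_of_isColimit hd i
      have := L.map_mono (d.inj i)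
      exact mono_comp (u (X i)).inv (L.map (d.inj i))
    have hp {i j : I} (hij : i ≠ j) :
        IsPullback (initial.to (X i)) (initial.to (X j)) (c.inj i) (c.inj j) :=
      ((isPullback_inj_of_isColimit hd hij).map L).of_iso
        ((initialIsInitial.isInitialObj L _).uniqueUpToIso initialIsInitial) (u (X i)) (u (X j))
        (.refl _) ((initialIsInitial.isInitialObj L _).hom_ext _ _)
        ((initialIsInitial.isInitialObj L _).hom_ext _ _)
        ((Category.comp_id _).trans ((u (X i)).hom_inv_id_assoc _).symm)
        ((Category.comp_id _).trans ((u (X j)).hom_inv_id_assoc _).symm)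
    exact CoproductDisjoint.of_cofan hc (fun hij => (hp hij).cone) (fun hij => (hp hij).isLimit)
      (fun hij => initialIsInitial)
  · rintro R X p₁ p₂ ⟨⟨e⟩⟩
    let q := coequalizer.π ((yo.{w} C).map p₁) ((yo.{w} C).map p₂)
    have hq := coequalizer.condition ((yo.{w} C).map p₁) ((yo.{w} C).map p₂)
    have hu {Y Z : C} (f : Y ⟶ Z) : L.map ((yo.{w} C).map f) ≫ (u Z).hom = (u Y).hom ≫ f :=
      adj.counit.naturality f
    have hπ : p₁ ≫ (u X).inv ≫ L.map q = p₂ ≫ (u X).inv ≫ L.map q := by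
      rw [← cancel_epi (u R).hom, ← reassoc_of% (hu p₁), ← reassoc_of% (hu p₂),
        Iso.hom_inv_id_assoc, ← L.map_comp, hq, L.map_comp]
    have hc := coequalizerIsCoequalizer ((yo.{w} C).map p₁) ((yo.{w} C).map p₂)
    have hL := Cofork.isColimitOfIsos _ (isColimitCoforkMapOfIsColimit L hq hc)
      (Cofork.ofπ _ hπ) (u R) (u X) (.refl _) (hu _).symm (hu _).symm
      (by simp; rfl)
    exact ⟨⟨{
      toEquivalenceRelation := e
      B := _
      π := (u X).inv ≫ L.map q
      isKernelPair := ((isKernelPair_yo e hc).map L).of_iso (u R) (u X) (u X) (.refl _)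
        (hu _) (hu _) ((Category.comp_id _).trans ((u X).hom_inv_id_assoc _).symm)
        ((Category.comp_id _).trans ((u X).hom_inv_id_assoc _).symm)
      -- Effectiveness asks for a pushout; reflexivity makes the coequalizer one.
      isPushout := .of_isColimit_cofork hL e.reflexivity₁ e.reflexivity₂ }⟩⟩

end

end LexCocompletion

/-! ### The action of a pseudoalgebra is left adjoint to Yoneda -/

namespace LexCocompletion

section

variable {C : Type u} [Category.{v} C] [LocallySmall.{w} C] {D : Type u'} [Category.{v'} D]

/-- A natural transformation out of a cocontinuous functor on small presheaves is determined by its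
components at representables. -/
theorem natTrans_ext_yo {G G' : SmallPresheaf.{w} C ⥤ D} [PreservesColimitsOfSize.{w, w} G]
    {α β : G ⟶ G'} (h : ∀ X, α.app ((yo.{w} C).obj X) = β.app ((yo.{w} C).obj X)) : α = β :=
  G.hom_ext_of_isLeftKanExtension (𝟙 (yo.{w} C ⋙ G)) _ _ (by ext X; simpa using h X)

theorem extIso_hom_app_yo {G G' : SmallPresheaf.{w} C ⥤ D} [PreservesColimitsOfSize.{w, w} G]
    [PreservesColimitsOfSize.{w, w} G'] (e : yo.{w} C ⋙ G ≅ yo.{w} C ⋙ G') (X : C) :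
    (extIso e).hom.app ((yo.{w} C).obj X) = e.hom.app X :=
  NatTrans.congr_app (whiskerLeft_extIso e) X

/-- The extension of a natural transformation between restrictions to representables. -/
noncomputable def extHom {G : SmallPresheaf.{w} C ⥤ D} [PreservesColimitsOfSize.{w, w} G]
    (G' : SmallPresheaf.{w} C ⥤ D) (α : yo.{w} C ⋙ G ⟶ yo.{w} C ⋙ G') : G ⟶ G' :=
  G.descOfIsLeftKanExtension (𝟙 (yo.{w} C ⋙ G)) G' α

theorem extHom_app_yo {G : SmallPresheaf.{w} C ⥤ D} [PreservesColimitsOfSize.{w, w} G]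
    (G' : SmallPresheaf.{w} C ⥤ D) (α : yo.{w} C ⋙ G ⟶ yo.{w} C ⋙ G') (X : C) :
    (extHom G' α).app ((yo.{w} C).obj X) = α.app X := by
  have := NatTrans.congr_app (G.descOfIsLeftKanExtension_fac (𝟙 (yo.{w} C ⋙ G)) G' α) X
  exact (Category.id_comp _).symm.trans this

/-- The transformation is the unique extension of its restriction to representables, and the
extension of an isomorphism is an isomorphism. -/
theorem isIso_of_isIso_app_yo {G G' : SmallPresheaf.{w} C ⥤ D} [PreservesColimitsOfSize.{w, w} G]
    [PreservesColimitsOfSize.{w, w} G'] (α : G ⟶ G')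
    (h : ∀ X, IsIso (α.app ((yo.{w} C).obj X))) : IsIso α := by
  have : IsIso (whiskerLeft (yo.{w} C) α) :=
    have (X : C) : IsIso ((whiskerLeft (yo.{w} C) α).app X) := h X
    NatIso.isIso_of_isIso_app _
  have e : α = (extIso (asIso (whiskerLeft (yo.{w} C) α))).hom :=
    natTrans_ext_yo fun X => (extIso_hom_app_yo (asIso (whiskerLeft (yo.{w} C) α)) X).symm
  rw [e]
  infer_instance

/-- Small presheaves are generated by representables. -/
theorem hom_ext_yo {φ ψ : SmallPresheaf.{w} C} {f g : φ ⟶ ψ}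
    (h : ∀ (X : C) (x : (yo.{w} C).obj X ⟶ φ), x ≫ f = x ≫ g) : f = g := by
  apply ObjectProperty.hom_ext
  ext X x
  have := congrArg yoEquiv (h X.unop (yoEquiv.symm x))
  rw [yoEquiv_comp, yoEquiv_comp, Equiv.apply_symm_apply] at this
  exact this

end

namespace Pseudoalgebra

variable {C : Type u} [Category.{v} C] [LocallySmall.{w} C] (A : Pseudoalgebra.{w} C)

variable (C) in
/-- The comparison between the two embeddings of small presheaves into iterated small presheaves. -/
noncomputable def mapYoToYo : map.{w} (yo.{w} C) ⟶ yo.{w} (SmallPresheaf.{w} C) :=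
  extHom _ (yoNat.{w} (yo.{w} C)).inv

/-- Although `yo` is not cocontinuous in general, `yo ⋙ mul` is, being isomorphic to the identity;
so invertibility is tested on representables, where the comparison is the inverse of `yoNat`. -/
instance : IsIso (whiskerRight (mapYoToYo.{w} C) (mul.{w} C)) := by
  have : PreservesColimitsOfSize.{w, w} (yo.{w} (SmallPresheaf.{w} C) ⋙ mul.{w} C) :=
    preservesColimits_of_natIso (yoMul.{w} C).symm
  refine isIso_of_isIso_app_yo _ fun X => ?_
  have : (mapYoToYo.{w} C).app ((yo.{w} C).obj X) = (yoNat.{w} (yo.{w} C)).inv.app X :=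
    extHom_app_yo _ _ X
  rw [whiskerRight_app, this]
  infer_instance

/-- A morphism from the identity to `A.act ⋙ yo C` inverted by `A.act`. -/
noncomputable def toYoAct : 𝟭 (SmallPresheaf.{w} C) ⟶ A.act ⋙ yo.{w} C :=
  (mapId.{w} C).inv ≫ (mapIso.{w} A.unitIso).inv ≫ (mapComp.{w} (yo.{w} C) A.act).hom ≫
    whiskerRight (mapYoToYo.{w} C) (map.{w} A.act) ≫ (yoNat.{w} A.act).inv

/-- Only the comparison factor of `toYoAct` may fail to be invertible. It is inverted by `mul`,
hence by `mul ⋙ act`, hence through `assocIso` by `map act ⋙ act`. -/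
instance (φ : SmallPresheaf.{w} C) : IsIso (A.act.map (A.toYoAct.app φ)) := by
  have : IsIso ((map.{w} A.act ⋙ A.act).map ((mapYoToYo.{w} C).app φ)) := by
    rw [NatIso.isIso_map_iff A.assocIso]
    have : IsIso ((mul.{w} C).map ((mapYoToYo.{w} C).app φ)) :=
      inferInstanceAs (IsIso ((whiskerRight (mapYoToYo.{w} C) (mul.{w} C)).app φ))
    exact inferInstanceAs (IsIso (A.act.map ((mul.{w} C).map ((mapYoToYo.{w} C).app φ))))
  have : IsIso (A.act.map ((map.{w} A.act).map ((mapYoToYo.{w} C).app φ))) := this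
  simp only [toYoAct, NatTrans.comp_app, Functor.map_comp, whiskerRight_app]
  infer_instance

/-- Naturality of `toYoAct` and density of representables equate the composites of `toYoAct` with
`yo k` and `yo k'`. Applying the action makes `toYoAct` cancellable, and `unitIso` conjugates what
remains back to `k` and `k'`. -/
theorem act_hom_ext {φ : SmallPresheaf.{w} C} {d : C} {k k' : A.act.obj φ ⟶ d}
    (h : ∀ (X : C) (x : (yo.{w} C).obj X ⟶ φ), A.act.map x ≫ k = A.act.map x ≫ k') : k = k' := by
  have h₁ : A.toYoAct.app φ ≫ (yo.{w} C).map k = A.toYoAct.app φ ≫ (yo.{w} C).map k' := by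
    refine hom_ext_yo fun X x => ?_
    have := A.toYoAct.naturality x
    dsimp at this
    rw [reassoc_of% this, reassoc_of% this, ← Functor.map_comp, ← Functor.map_comp, h]
  have h₂ := congrArg A.act.map h₁
  rw [Functor.map_comp, Functor.map_comp, cancel_epi] at h₂
  have n (t : A.act.obj φ ⟶ d) := A.unitIso.hom.naturality t
  dsimp at n
  rw [← cancel_epi (A.unitIso.hom.app _), ← n, h₂, n]

/-- The unit of the adjunction between the action and the Yoneda embedding. -/
noncomputable def unit : 𝟭 (SmallPresheaf.{w} C) ⟶ A.act ⋙ yo.{w} C :=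
  extHom _ ((yo.{w} C).rightUnitor.hom ≫ (yo.{w} C).leftUnitor.inv ≫
    whiskerRight A.unitIso.inv (yo.{w} C) ≫ (Functor.associator _ _ _).hom)

theorem unit_app_yo (X : C) :
    A.unit.app ((yo.{w} C).obj X) = (yo.{w} C).map (A.unitIso.inv.app X) :=
  (extHom_app_yo _ _ X).trans (by simp)

/-- The action of a pseudoalgebra is left adjoint to the Yoneda embedding. -/
noncomputable def adjunction : A.act ⊣ yo.{w} C :=
  Adjunction.mkOfUnitCounit
    { unit := A.unit
      counit := A.unitIso.hom
      left_triangle := by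
        ext φ
        -- The triangle is tested on representables, where the unit is `yo` of the inverse of
        -- `unitIso`.
        refine A.act_hom_ext fun X x => ?_
        have h₁ := A.unit.naturality x
        have h₂ := A.unitIso.hom.naturality (A.unitIso.inv.app X ≫ A.act.map x)
        simp only [Functor.id_map, Functor.comp_map, unit_app_yo, ← Functor.map_comp] at h₁ h₂
        suffices A.act.map x ≫ A.act.map (A.unit.app φ) ≫ A.unitIso.hom.app (A.act.obj φ) =
          A.act.map x by simpa
        rw [← Functor.map_comp_assoc, h₁, h₂]
        exact A.unitIso.hom_inv_id_app_assoc X _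
      right_triangle := by
        ext X
        simp [unit_app_yo, ← Functor.map_comp] }

end Pseudoalgebra

theorem LexPseudoalgebra.hasLexReflector {C : Type u} [Category.{w} C] [HasFiniteLimits C]
    (A : LexPseudoalgebra.{w} C) : HasLexReflector.{w} C :=
  ⟨A.act, ⟨A.adjunction⟩, A.lex⟩

end LexCocompletion

/-! ### A reflector is a pseudoalgebra -/

namespace LexCocompletion

section

variable {C : Type u} [Category.{v} C] [LocallySmall.{w} C]
variable {D : Type u'} [Category.{v'} D] [LocallySmall.{w} D]
variable {E : Type u''} [Category.{v''} E] [LocallySmall.{w} E]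

theorem mapId_hom_app_yo (X : C) :
    (mapId.{w} C).hom.app ((yo.{w} C).obj X) = (yoNat.{w} (𝟭 C)).inv.app X :=
  (extIso_hom_app_yo _ X).trans (by simp)

theorem mapComp_hom_app_yo (F : C ⥤ D) (G : D ⥤ E) (X : C) :
    (mapComp.{w} F G).hom.app ((yo.{w} C).obj X) = (yoNat.{w} (F ⋙ G)).inv.app X ≫
      (yoNat.{w} G).hom.app (F.obj X) ≫ (map.{w} G).map ((yoNat.{w} F).hom.app X) :=
  (extIso_hom_app_yo _ X).trans (by simp)

/-- The value of `mapComp` on representables, solved for its inverse; this is the form in which the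
coherence axioms meet it. -/
theorem map_yoNat_comp_mapComp_inv_app_yo (F : C ⥤ D) (G : D ⥤ E) (X : C) :
    (map.{w} G).map ((yoNat.{w} F).hom.app X) ≫ (mapComp.{w} F G).inv.app ((yo.{w} C).obj X) =
      (yoNat.{w} G).inv.app (F.obj X) ≫ (yoNat.{w} (F ⋙ G)).hom.app X := by
  have h := (mapComp.{w} F G).hom_inv_id_app ((yo.{w} C).obj X)
  rw [mapComp_hom_app_yo, Category.assoc, Category.assoc, ← Iso.app_inv, Iso.inv_comp_eq,
    ← Iso.app_hom _ (F.obj X), ← Iso.eq_inv_comp] at h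
  exact h.trans (congrArg _ (Category.comp_id _))

theorem mapIso_hom_app_yo {F G : C ⥤ D} (α : F ≅ G) (X : C) :
    (yoNat.{w} F).hom.app X ≫ (mapIso.{w} α).hom.app ((yo.{w} C).obj X) =
      (yo.{w} D).map (α.hom.app X) ≫ (yoNat.{w} G).hom.app X :=
  (NatTrans.congr_app ((yo.{w} C).lanUnit.naturality (whiskerRight α.hom (yo.{w} D))) X).symm

theorem mapYoMul_hom_app_yo (X : C) :
    (mapYoMul.{w} C).hom.app ((yo.{w} C).obj X) =
      (mul.{w} C).map ((yoNat.{w} (yo.{w} C)).inv.app X) ≫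
        (yoMul.{w} C).hom.app ((yo.{w} C).obj X) := by
  have : PreservesColimitsOfSize.{w, w} (map.{w} (yo.{w} C) ⋙ mul.{w} C) := inferInstance
  exact (extIso_hom_app_yo _ X).trans (by simp)

theorem mulNat_hom_app_yo (F : C ⥤ D) (φ : SmallPresheaf.{w} C) :
    (mulNat.{w} F).hom.app ((yo.{w} _).obj φ) = (mul.{w} D).map ((yoNat.{w} (map.{w} F)).inv.app φ) ≫
      (yoMul.{w} D).hom.app ((map.{w} F).obj φ) ≫ (map.{w} F).map ((yoMul.{w} C).inv.app φ) :=
  (extIso_hom_app_yo _ φ).trans (by simp)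

theorem mulAssoc_hom_app_yo (φ : SmallPresheaf.{w} (SmallPresheaf.{w} C)) :
    (mulAssoc.{w} C).hom.app ((yo.{w} _).obj φ) =
      (mul.{w} C).map ((yoNat.{w} (mul.{w} C)).inv.app φ) ≫
      (yoMul.{w} C).hom.app ((mul.{w} C).obj φ) ≫
      (mul.{w} C).map ((yoMul.{w} (SmallPresheaf.{w} C)).inv.app φ) :=
  (extIso_hom_app_yo _ φ).trans (by simp)

end

section

variable {C : Type u} [Category.{v} C] [LocallySmall.{w} C]
  (L : SmallPresheaf.{w} C ⥤ C) [PreservesColimitsOfSize.{w, w} L] (υ : yo.{w} C ⋙ L ≅ 𝟭 C)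

/-- The associativity 2-cell of a cocontinuous retraction of the Yoneda embedding. -/
noncomputable def assocIsoOfUnitIso : map.{w} L ⋙ L ≅ mul.{w} C ⋙ L :=
  extIso (isoWhiskerRight (yoNat.{w} L).symm L ≪≫ isoWhiskerLeft L υ ≪≫ L.rightUnitor ≪≫
    L.leftUnitor.symm ≪≫ isoWhiskerRight (yoMul.{w} C).symm L)

theorem assocIsoOfUnitIso_hom_app_yo (φ : SmallPresheaf.{w} C) :
    (assocIsoOfUnitIso L υ).hom.app ((yo.{w} _).obj φ) =
      L.map ((yoNat.{w} L).inv.app φ) ≫ υ.hom.app (L.obj φ) ≫ L.map ((yoMul.{w} C).inv.app φ) :=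
  (extIso_hom_app_yo _ φ).trans (by simp)

/-- A cocontinuous retraction of the Yoneda embedding is a pseudoalgebra. -/
noncomputable def pseudoalgebraOfUnitIso : Pseudoalgebra.{w} C where
  act := L
  unitIso := υ
  assocIso := assocIsoOfUnitIso L υ
  unit_coherence := by
    refine Iso.ext (natTrans_ext_yo fun X => ?_)
    suffices (assocIsoOfUnitIso L υ).hom.app ((map.{w} (yo.{w} C)).obj ((yo.{w} C).obj X)) ≫
          L.map ((mapYoMul.{w} C).hom.app ((yo.{w} C).obj X)) =
        L.map ((mapComp.{w} (yo.{w} C) L).inv.app ((yo.{w} C).obj X)) ≫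
          L.map ((mapIso.{w} υ).hom.app ((yo.{w} C).obj X)) ≫
          L.map ((mapId.{w} C).hom.app ((yo.{w} C).obj X)) by simpa
    have n := (assocIsoOfUnitIso L υ).hom.naturality ((yoNat.{w} (yo.{w} C)).hom.app X)
    -- Naturality of `υ` at its own component, with that component cancelled.
    have hυ : L.map ((yo.{w} C).map (υ.hom.app X)) = υ.hom.app (L.obj ((yo.{w} C).obj X)) := by
      rw [← cancel_mono (υ.hom.app X)]
      exact υ.hom.naturality (υ.hom.app X)
    dsimp at n
    -- The associativity cell is known only on representables, and `map yo` of a representable is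
    -- merely isomorphic to one through `yoNat`; precomposing with the image of that isomorphism
    -- allows the explicit formula to be used.
    rw [← cancel_epi (L.map ((map.{w} L).map ((yoNat.{w} (yo.{w} C)).hom.app X))),
      reassoc_of% n, ← L.map_comp_assoc, map_yoNat_comp_mapComp_inv_app_yo, L.map_comp_assoc,
      ← L.map_comp_assoc ((yoNat.{w} (yo.{w} C ⋙ L)).hom.app X), mapIso_hom_app_yo,
      L.map_comp_assoc, hυ, mapId_hom_app_yo, assocIsoOfUnitIso_hom_app_yo, mapYoMul_hom_app_yo]
    have c₁ : L.map ((mul.{w} C).map ((yoNat.{w} (yo.{w} C)).hom.app X)) ≫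
        L.map ((mul.{w} C).map ((yoNat.{w} (yo.{w} C)).inv.app X)) = 𝟙 _ := by
      simp only [← Functor.map_comp, Iso.hom_inv_id_app, CategoryTheory.Functor.map_id]
    simp [reassoc_of% c₁]
  assoc_coherence := by
    refine Iso.ext (natTrans_ext_yo fun X => ?_)
    let Y := (yo.{w} (SmallPresheaf.{w} (SmallPresheaf.{w} C))).obj X
    suffices L.map ((mapComp.{w} (map.{w} L) L).inv.app Y) ≫
          L.map ((mapIso.{w} (assocIsoOfUnitIso L υ)).hom.app Y) ≫
          L.map ((mapComp.{w} (mul.{w} C) L).hom.app Y) ≫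
          (assocIsoOfUnitIso L υ).hom.app ((map.{w} (mul.{w} C)).obj Y) ≫
          L.map ((mulAssoc.{w} C).hom.app Y) =
        (assocIsoOfUnitIso L υ).hom.app ((map.{w} (map.{w} L)).obj Y) ≫
          L.map ((mulNat.{w} L).hom.app Y) ≫
          (assocIsoOfUnitIso L υ).hom.app ((mul.{w} (SmallPresheaf.{w} C)).obj Y) by simpa
    have n := (assocIsoOfUnitIso L υ).hom.naturality ((yoNat.{w} (map.{w} L)).hom.app X)
    have n' := (assocIsoOfUnitIso L υ).hom.naturality ((yoNat.{w} (mul.{w} C)).hom.app X)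
    have n'' := (assocIsoOfUnitIso L υ).hom.naturality
      ((yoMul.{w} (SmallPresheaf.{w} C)).inv.app X)
    have hυ := υ.hom.naturality ((assocIsoOfUnitIso L υ).hom.app X)
    dsimp at n n' n'' hυ
    rw [assocIsoOfUnitIso_hom_app_yo] at n'
    have c₁ : L.map ((mul.{w} C).map ((yoNat.{w} (map.{w} L)).hom.app X)) ≫
        L.map ((mul.{w} C).map ((yoNat.{w} (map.{w} L)).inv.app X)) = 𝟙 _ := by
      simp only [← Functor.map_comp, Iso.hom_inv_id_app, CategoryTheory.Functor.map_id]
    have c₂ : L.map ((mul.{w} C).map ((yoNat.{w} (mul.{w} C)).hom.app X)) ≫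
        L.map ((mul.{w} C).map ((yoNat.{w} (mul.{w} C)).inv.app X)) = 𝟙 _ := by
      simp only [← Functor.map_comp, Iso.hom_inv_id_app, CategoryTheory.Functor.map_id]
    -- As for the unit axiom, naturality reduces the associativity cells to explicit values: `n` and
    -- `n'` move two of them to representables, `n''` moves one along `yoMul`, and `hυ` exchanges
    -- the cell with `υ`.
    rw [← cancel_epi (L.map ((map.{w} L).map ((yoNat.{w} (map.{w} L)).hom.app X))),
      reassoc_of% n, ← L.map_comp_assoc, map_yoNat_comp_mapComp_inv_app_yo, L.map_comp_assoc,
      ← L.map_comp_assoc ((yoNat.{w} (map.{w} L ⋙ L)).hom.app X), mapIso_hom_app_yo,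
      mapComp_hom_app_yo, mulNat_hom_app_yo, mulAssoc_hom_app_yo, assocIsoOfUnitIso_hom_app_yo]
    simp [Y, reassoc_of% c₁, reassoc_of% n', n'', reassoc_of% c₂, reassoc_of% hυ]

end

theorem HasLexReflector.nonempty_lexPseudoalgebra {C : Type u} [Category.{w} C] [HasFiniteLimits C]
    (h : HasLexReflector.{w} C) : Nonempty (LexPseudoalgebra.{w} C) := by
  obtain ⟨L, ⟨adj⟩, hL⟩ := h
  have : PreservesColimitsOfSize.{w, w} L := adj.leftAdjoint_preservesColimits
  exact ⟨{ toPseudoalgebra := pseudoalgebraOfUnitIso L (asIso adj.counit), lex := hL }⟩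

end LexCocompletion

theorem mainTheorem12 (C : Type u) [Category.{w} C] [HasFiniteLimits C] :
    (Nonempty (LexCocompletion.LexPseudoalgebra.{w} C) ↔ IsInftyPretopos.{w} C) ∧
    (LexCocompletion.HasLexReflector.{w} C ↔ IsInftyPretopos.{w} C) :=
  ⟨⟨fun ⟨A⟩ => A.hasLexReflector.isInftyPretopos,
      fun h => h.hasLexReflector.nonempty_lexPseudoalgebra⟩,
    ⟨fun h => h.isInftyPretopos, fun h => h.hasLexReflector⟩⟩
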